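/- **Setting.** Let $\alpha\in(0,1)$, $p_0<p_1<0$, $\ell,g,\sigma>0$, $\varrho_1<\varrho_2$, and let $\gamma\in C^{0,\alpha}([0,|p_1|])$. Write $[\![\varrho]\!]=\varrho_1-\varrho_2$. Let $\Gamma>0$ on $[p_1,0]$ satisfy $(\Gamma(p)^2)'=2\gamma(-p)$ and $\ell=\int_{p_1}^0\Gamma(p)^{-1}\,dp$. Over one period let $D_1=(0,2\pi)\times(p_1,0)$ (air), $D_2=(0,2\pi)\times(p_0,p_1)$ (water), $I=\{p=p_1\}$, $T=\{p=0\}$, $B=\{p=p_0\}$. Superscripts $(1),(2)$ denote restrictions to the air and to the water strip, $[\![f]\!]=f^{(1)}-f^{(2)}$ on $I$, and $d(h)=\frac1{2\pi}\int_{-\pi}^{\pi}h(q,p_1)\,dq$. For $\lambda>0$ the laminar flow is $$H(p;\lambda)=\int_{p_1}^p\frac{ds}{\Gamma(s)}+\frac{p_1-p_0}{\lambda}\ (p_1\le p\le 0),\qquad H(p;\lambda)=\frac{p-p_0}{\lambda}\ (p_0\le p\le p_1),$$ $$Q(\lambda)=\frac{2g[\![\varrho]\!](p_1-p_0)}{\lambda}+\Gamma(p_1)^2-\lambda^2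 ,$$ and $a=H_p^{-1}$, that is, $a=\Gamma$ in the air and $a=\lambda$ in the water. The subscript "per" means $2\pi$-periodic and even in $q$. Let $X$ be the space of functions on $\{p_0\le p\le 0\}$ that are continuous, of class $C^{2,\alpha}_{\rm per}$ on each of the two closed strips, and zero on $B$; let $Y=C^{0,\alpha}_{\rm per}(\overline{D_1})\times C^{0,\alpha}_{\rm per}(\overline{D_2})\times C^{0,\alpha}_{\rm per}(I)\times C^{2,\alpha}_{\rm per}(T)$; both carry their Hölder norms. For $\lambda>0$ and $m\in X$ with $\inf(m_p+H_p)>0$ let $\mathcal F(\lambda,m)=(\mathcal F_1,\mathcal F_2,\mathcal F_3,\mathcal F_4)$, where $$\mathcal F_1=(1+m_q^2)(m_{pp}+H_{pp})+m_{qq}(m_p+H_p)^2-2m_q(H_p+m_p)m_{pq}+\gamma(-p)(H_p+m_p)^3\ \text{ in the air},$$ $$\mathcal F_2=(1+m_q^2)(m_{pp}+H_{pp})+m_{qq}(m_p+H_p)^2-2m_q(H_p+m_p)m_{pq}\ \text{ in the water},$$ $$\mathcal F_3=-\Big[\!\!\Big[\frac{1+m_q^2}{(H_p+m_p)^2}\Big]\!\!\Big]-2g[\![\varrho]\!](m+H)+Q-\frac{\sigma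 m_{qq}}{(1+m_q^2)^{3/2}}\ \text{ on } I,$$ $$\mathcal F_4=\big(m+H-\ell-d(m)-d(H)\big)\big|_T .$$ Let $\lambda^*>0$ be such that the problem $$(a^3M_p)_p=aM\ \text{ in }(p_0,p_1)\cup(p_1,0),\qquad 2[\![a^3M_p]\!]-2g[\![\varrho]\!]M=-\sigma M\ \text{ at }p_1,\qquad M(p_0)=M(0)=0,$$ with $a=a(\cdot;\lambda^*)$, has a nontrivial solution $M=\varphi_1$ (continuous, and differentiable up to the end points on each closed interval), and suppose that $\varphi^*(q,p):=\varphi_1(p)\cos q$ belongs to $X$. **Lemma (transversality).** The map $\mathcal F(\lambda,\cdot)$ takes values in $Y$. The Fréchet derivative $\mathcal F_m(\lambda,0)\in\mathcal L(X,Y)$ exists for every $\lambda>0$, the map $\lambda\mapsto\mathcal F_m(\lambda,0)$ is differentiable at $\lambda^*$ in operator norm, with derivative $\mathcal F_{\lambda m}(\lambda^*,0)$, and $\mathcal F_m(\lambda^*,0)\varphi^*=0$. Moreover $$\mathcal F_{\lambda m}(\lambda^*,0)\varphi^*\notin\mathcal R(\mathcal F_m(\lambda^*,0)).$$ More precisely,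 for $\mathcal A\in Y$ put $$\Xi(\mathcal A)=\iint_{D_1}a^3\mathcal A_1\varphi^*\,dq\,dp+\iint_{D_2}a^3\mathcal A_2\varphi^*\,dq\,dp+\frac12\int_I\mathcal A_3\varphi^*\,dq+\int_Ta^3\mathcal A_4\varphi^*_p\,dq ,$$ with $a=a(\cdot;\lambda^*)$. Then $\Xi$ vanishes on $\mathcal R(\mathcal F_m(\lambda^*,0))$, whereas $$\Xi\big(\mathcal F_{\lambda m}(\lambda^*,0)\varphi^*\big)=-\iint_{D_2}(\varphi^*)^2\,dq\,dp-3(\lambda^*)^2\iint_{D_2}(\varphi^*_p)^2\,dq\,dp<0 .$$ -/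

import Mathlib

open Set Topology
open scoped NNReal

/-! ### Hölder spaces -/

/-- Bounded (continuous) real functions on `K` that are Hölder continuous with exponent `α`. -/
def holderSubmodule (α : ℝ≥0) (K : Type) [MetricSpace K] :
    Submodule ℝ (BoundedContinuousFunction K ℝ) where
  carrier := {f | MemHolder α (f : K → ℝ)}
  add_mem' hf hg := MemHolder.add hf hg
  zero_mem' := memHolder_zero
  smul_mem' c _ hf := MemHolder.smul (c := c) hf

/-- The space `C^{0,α}(K)`. -/
def HolderSpace (α : ℝ≥0) (K : Type) [MetricSpace K] : Type := ↥(holderSubmodule α K)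

namespace HolderSpace

variable {α : ℝ≥0} {K : Type} [MetricSpace K]

noncomputable instance : AddCommGroup (HolderSpace α K) :=
  inferInstanceAs (AddCommGroup ↥(holderSubmodule α K))

noncomputable instance : Module ℝ (HolderSpace α K) :=
  inferInstanceAs (Module ℝ ↥(holderSubmodule α K))

/-- The underlying bounded continuous function. -/
def toBCF (f : HolderSpace α K) : BoundedContinuousFunction K ℝ := f.1

instance : CoeFun (HolderSpace α K) (fun _ => K → ℝ) := ⟨fun f => f.toBCF⟩

theorem memHolder (f : HolderSpace α K) : MemHolder α (f : K → ℝ) := f.2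

@[simp] theorem toBCF_add (f g : HolderSpace α K) : (f + g).toBCF = f.toBCF + g.toBCF := rfl

@[simp] theorem toBCF_smul (c : ℝ) (f : HolderSpace α K) : (c • f).toBCF = c • f.toBCF := rfl

@[simp] theorem toBCF_zero : (0 : HolderSpace α K).toBCF = 0 := rfl

theorem toBCF_injective : Function.Injective (toBCF : HolderSpace α K → _) :=
  Subtype.val_injective

/-- The Hölder norm `sup |f| + [f]_α`. -/
noncomputable instance : Norm (HolderSpace α K) :=
  ⟨fun f => ‖f.toBCF‖ + (nnHolderNorm α (f : K → ℝ) : ℝ)⟩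

theorem norm_def (f : HolderSpace α K) :
    ‖f‖ = ‖f.toBCF‖ + (nnHolderNorm α (f : K → ℝ) : ℝ) := rfl

theorem normCore : NormedSpace.Core ℝ (HolderSpace α K) where
  norm_nonneg f := by rw [norm_def]; positivity
  norm_smul c f := by
    have h : nnHolderNorm α ((c • f : HolderSpace α K) : K → ℝ)
        = ‖c‖₊ * nnHolderNorm α (f : K → ℝ) := MemHolder.nnHolderNorm_smul f.memHolder c
    rw [norm_def, norm_def, h, toBCF_smul, norm_smul]
    push_cast
    ring
  norm_triangle f g := by
    have h : nnHolderNorm α ((f + g : HolderSpace α K) : K → ℝ)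
        ≤ nnHolderNorm α (f : K → ℝ) + nnHolderNorm α (g : K → ℝ) :=
      MemHolder.nnHolderNorm_add_le f.memHolder g.memHolder
    have h' : (nnHolderNorm α ((f + g : HolderSpace α K) : K → ℝ) : ℝ)
        ≤ nnHolderNorm α (f : K → ℝ) + nnHolderNorm α (g : K → ℝ) := by exact_mod_cast h
    have h2 := norm_add_le f.toBCF g.toBCF
    rw [norm_def, norm_def, norm_def, toBCF_add]
    rw [toBCF_add] at h'
    linarith
  norm_eq_zero_iff f := by
    constructor
    · intro h
      rw [norm_def] at h
      have h1 := norm_nonneg f.toBCF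
      have h2 := (nnHolderNorm α (f : K → ℝ)).coe_nonneg
      have h3 : ‖f.toBCF‖ = 0 := by linarith
      exact toBCF_injective (by simpa using h3)
    · rintro rfl
      rw [norm_def, toBCF_zero, norm_zero]
      simp

noncomputable instance : NormedAddCommGroup (HolderSpace α K) :=
  NormedAddCommGroup.ofCore normCore

noncomputable instance : NormedSpace ℝ (HolderSpace α K) := NormedSpace.ofCore normCore

end HolderSpace

/-! ### Functions on closed strips -/

/-- The closed strip `{(q, p) : q ∈ ℝ, b ≤ p ≤ t}`. -/
abbrev Strip (b t : ℝ) : Type := ℝ × ↥(Icc b t)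

/-- The value at `(q, p)` of a Hölder function on the closed strip (the variable `p`, which is
only used in `[b, t]`, is projected to `[b, t]` to make this total). -/
noncomputable def HolderSpace.at {α : ℝ≥0} {b t : ℝ} (f : HolderSpace α (Strip b t)) (h : b ≤ t)
    (q p : ℝ) : ℝ := f (q, projIcc b t h p)

/-- Even and `2π`-periodic dependence on the horizontal variable, for functions on a strip. -/
def IsPerEven {b t : ℝ} (f : Strip b t → ℝ) : Prop :=
  ∀ (q : ℝ) (p : ↥(Icc b t)), f (q + 2 * Real.pi, p) = f (q, p) ∧ f (-q, p) = f (q, p)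

/-- Labels for the derivatives of order at most two: `o` is the function itself. -/
inductive JetIx
  | o | q | p | qq | qp | pp

instance : Fintype JetIx where
  elems := ⟨([.o, .q, .p, .qq, .qp, .pp] : List JetIx), by simp⟩
  complete x := by cases x <;> simp

/-- `u` consists of a function `u .o` on the closed strip and its partial derivatives up to order
two (one-sided in `p` on the two boundary lines). As the derivatives are determined by `u .o`, the
families `u` of `C^{0,α}` functions with this property are the functions of class `C^{2,α}` up to
the boundary, and the maximum of the `C^{0,α}` norms is a norm of `C^{2,α}`. -/
structure IsStripJet {α : ℝ≥0} {b t : ℝ} (h : b ≤ t) (u : JetIx → HolderSpace α (Strip b t)) :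
    Prop where
  q : ∀ q, ∀ p ∈ Icc b t, HasDerivAt (fun s => (u .o).at h s p) ((u .q).at h q p) q
  p : ∀ q, ∀ p ∈ Icc b t,
    HasDerivWithinAt (fun s => (u .o).at h q s) ((u .p).at h q p) (Icc b t) p
  qq : ∀ q, ∀ p ∈ Icc b t, HasDerivAt (fun s => (u .q).at h s p) ((u .qq).at h q p) q
  qp : ∀ q, ∀ p ∈ Icc b t,
    HasDerivWithinAt (fun s => (u .q).at h q s) ((u .qp).at h q p) (Icc b t) p
  pq : ∀ q, ∀ p ∈ Icc b t, HasDerivAt (fun s => (u .p).at h s p) ((u .qp).at h q p) q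
  pp : ∀ q, ∀ p ∈ Icc b t,
    HasDerivWithinAt (fun s => (u .p).at h q s) ((u .pp).at h q p) (Icc b t) p

/-- The space `C^{2,α}_per` of a closed strip: functions of class `C^{2,α}` up to the boundary that
are `2π`-periodic and even in `q`, each recorded together with its derivatives. -/
def stripC2 (α : ℝ≥0) {b t : ℝ} (h : b ≤ t) :
    Submodule ℝ (JetIx → HolderSpace α (Strip b t)) where
  carrier := {u | IsStripJet h u ∧ IsPerEven (u .o)}
  add_mem' := by
    rintro u v ⟨hu, hu'⟩ ⟨hv, hv'⟩
    refine ⟨⟨fun q p hp => (hu.q q p hp).add (hv.q q p hp),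
      fun q p hp => (hu.p q p hp).add (hv.p q p hp),
      fun q p hp => (hu.qq q p hp).add (hv.qq q p hp),
      fun q p hp => (hu.qp q p hp).add (hv.qp q p hp),
      fun q p hp => (hu.pq q p hp).add (hv.pq q p hp),
      fun q p hp => (hu.pp q p hp).add (hv.pp q p hp)⟩, fun q p => ?_⟩
    simp [(hu' q p).1, (hu' q p).2, (hv' q p).1, (hv' q p).2]
  zero_mem' := by
    refine ⟨⟨fun q p _ => hasDerivAt_const q 0, fun q p _ => hasDerivWithinAt_const p _ 0,
      fun q p _ => hasDerivAt_const q 0, fun q p _ => hasDerivWithinAt_const p _ 0,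
      fun q p _ => hasDerivAt_const q 0, fun q p _ => hasDerivWithinAt_const p _ 0⟩,
      fun q p => ⟨rfl, rfl⟩⟩
  smul_mem' := by
    rintro c u ⟨hu, hu'⟩
    refine ⟨⟨fun q p hp => (hu.q q p hp).const_smul c, fun q p hp => (hu.p q p hp).const_smul c,
      fun q p hp => (hu.qq q p hp).const_smul c, fun q p hp => (hu.qp q p hp).const_smul c,
      fun q p hp => (hu.pq q p hp).const_smul c, fun q p hp => (hu.pp q p hp).const_smul c⟩,
      fun q p => ?_⟩
    simp [(hu' q p).1, (hu' q p).2]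

/-- The space `C^{0,α}_per` of a closed strip. -/
def stripC0 (α : ℝ≥0) (b t : ℝ) : Submodule ℝ (HolderSpace α (Strip b t)) where
  carrier := {f | IsPerEven f}
  add_mem' := by
    intro f g hf hg q p
    simp [(hf q p).1, (hf q p).2, (hg q p).1, (hg q p).2]
  zero_mem' := fun q p => ⟨rfl, rfl⟩
  smul_mem' := by
    intro c f hf q p
    simp [(hf q p).1, (hf q p).2]

/-- The space `C^{0,α}_per` of a horizontal line. -/
def lineC0 (α : ℝ≥0) : Submodule ℝ (HolderSpace α ℝ) where
  carrier := {f | ∀ q, f (q + 2 * Real.pi) = f q ∧ f (-q) = f q}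
  add_mem' := by
    intro f g hf hg q
    simp [(hf q).1, (hf q).2, (hg q).1, (hg q).2]
  zero_mem' := fun q => ⟨rfl, rfl⟩
  smul_mem' := by
    intro c f hf q
    simp [(hf q).1, (hf q).2]

/-- The space `C^{2,α}_per` of a horizontal line: `u 0` is the function, `u 1` and `u 2` are its
first and second derivatives. -/
def lineC2 (α : ℝ≥0) : Submodule ℝ (Fin 3 → HolderSpace α ℝ) where
  carrier := {u | (∀ q, HasDerivAt (u 0) (u 1 q) q) ∧ (∀ q, HasDerivAt (u 1) (u 2 q) q) ∧
    ∀ q, u 0 (q + 2 * Real.pi) = u 0 q ∧ u 0 (-q) = u 0 q}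
  add_mem' := by
    rintro u v ⟨hu, hu', hu''⟩ ⟨hv, hv', hv''⟩
    refine ⟨fun q => (hu q).add (hv q), fun q => (hu' q).add (hv' q), fun q => ?_⟩
    simp [(hu'' q).1, (hu'' q).2, (hv'' q).1, (hv'' q).2]
  zero_mem' := ⟨fun q => hasDerivAt_const q 0, fun q => hasDerivAt_const q 0,
    fun q => ⟨rfl, rfl⟩⟩
  smul_mem' := by
    rintro c u ⟨hu, hu', hu''⟩
    refine ⟨fun q => (hu q).const_smul c, fun q => (hu' q).const_smul c, fun q => ?_⟩
    simp [(hu'' q).1, (hu'' q).2]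

/-! ### The wind-wave problem in the Dubreil-Jacotin variables -/

/-- The data of the problem, with the standing assumptions. Air occupies `p₁ < p < 0`, water
occupies `p₀ < p < p₁`; `γ` is the vorticity strength function in the air, `Γ` the relative
circulation, which is tied to `γ` and to the lid height `ℓ` by the compatibility condition. -/
structure WindWave where
  α : ℝ≥0
  (p₀ p₁ ℓ g ρ₁ ρ₂ σ : ℝ)
  (γ Γ : ℝ → ℝ)
  α_pos : 0 < α
  α_lt_one : α < 1
  p₀_lt : p₀ < p₁
  p₁_neg : p₁ < 0
  ℓ_pos : 0 < ℓ
  g_pos : 0 < g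
  ρ_lt : ρ₁ < ρ₂
  σ_pos : 0 < σ
  γ_holder : MemHolder α ((Icc 0 (-p₁)).domRestrict γ)
  Γ_pos : ∀ p ∈ Icc p₁ 0, 0 < Γ p
  Γ_deriv : ∀ p ∈ Icc p₁ 0, HasDerivWithinAt (fun s => Γ s ^ 2) (2 * γ (-p)) (Icc p₁ 0) p
  Γ_lid : ℓ = ∫ p in p₁..0, (Γ p)⁻¹

namespace WindWave

variable (W : WindWave)

/-- The jump of the density, air minus water. -/
def ρJump : ℝ := W.ρ₁ - W.ρ₂

/-- The mean value over a period, which gives the depth operator when applied to the trace of a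
height function on the interface. -/
noncomputable def depth (f : ℝ → ℝ) : ℝ :=
  1 / (2 * Real.pi) * ∫ q in (-Real.pi)..Real.pi, f q

/-- The laminar height function in the air. -/
noncomputable def H₁ (lam p : ℝ) : ℝ := (∫ s in W.p₁..p, (W.Γ s)⁻¹) + (W.p₁ - W.p₀) / lam

/-- The laminar height function in the water. -/
noncomputable def H₂ (lam p : ℝ) : ℝ := (p - W.p₀) / lam

/-- First derivative of the laminar height function in the closed air interval. -/
noncomputable def H₁p (lam : ℝ) : ℝ → ℝ := derivWithin (W.H₁ lam) (Icc W.p₁ 0)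

/-- Second derivative of the laminar height function in the closed air interval. -/
noncomputable def H₁pp (lam : ℝ) : ℝ → ℝ := derivWithin (W.H₁p lam) (Icc W.p₁ 0)

/-- First derivative of the laminar height function in the closed water interval. -/
noncomputable def H₂p (lam : ℝ) : ℝ → ℝ := derivWithin (W.H₂ lam) (Icc W.p₀ W.p₁)

/-- Second derivative of the laminar height function in the closed water interval. -/
noncomputable def H₂pp (lam : ℝ) : ℝ → ℝ := derivWithin (W.H₂p lam) (Icc W.p₀ W.p₁)

/-- The parameter `Q` of the laminar solution. -/
noncomputable def Q (lam : ℝ) : ℝ :=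
  2 * W.g * W.ρJump * (W.p₁ - W.p₀) / lam + W.Γ W.p₁ ^ 2 - lam ^ 2

/-- The space `X`: pairs of a `C^{2,α}_per` function on the closed air strip and one on the closed
water strip that agree on the interface `p = p₁` and vanish on the bed `p = p₀`. -/
def X : Submodule ℝ ((JetIx → HolderSpace W.α (Strip W.p₁ 0)) ×
    (JetIx → HolderSpace W.α (Strip W.p₀ W.p₁))) where
  carrier := {m | m.1 ∈ stripC2 W.α W.p₁_neg.le ∧ m.2 ∈ stripC2 W.α W.p₀_lt.le ∧
    (∀ q, (m.1 .o).at W.p₁_neg.le q W.p₁ = (m.2 .o).at W.p₀_lt.le q W.p₁) ∧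
    ∀ q, (m.2 .o).at W.p₀_lt.le q W.p₀ = 0}
  add_mem' := by
    rintro u v ⟨h1, h2, h3, h4⟩ ⟨k1, k2, k3, k4⟩
    exact ⟨add_mem h1 k1, add_mem h2 k2, fun q => congrArg₂ (· + ·) (h3 q) (k3 q),
      fun q => (congrArg₂ (· + ·) (h4 q) (k4 q)).trans (add_zero 0)⟩
  zero_mem' := ⟨zero_mem _, zero_mem _, fun q => rfl, fun q => rfl⟩
  smul_mem' := by
    rintro c u ⟨h1, h2, h3, h4⟩
    exact ⟨Submodule.smul_mem _ c h1, Submodule.smul_mem _ c h2,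
      fun q => congrArg (c * ·) (h3 q), fun q => (congrArg (c * ·) (h4 q)).trans (mul_zero c)⟩

/-- The space `Y = Y₁ × Y₂ × Y₃ × Y₄`. -/
abbrev Y : Type :=
  ↥(stripC0 W.α W.p₁ 0) × ↥(stripC0 W.α W.p₀ W.p₁) × ↥(lineC0 W.α) × ↥(lineC2 W.α)

variable {W}

/-- `m.air i q p` is the derivative with label `i` of the air part `m^{(1)}` at `(q, p)`. -/
noncomputable def X.air (m : W.X) (i : JetIx) (q p : ℝ) : ℝ := (m.1.1 i).at W.p₁_neg.le q p

/-- `m.water i q p` is the derivative with label `i` of the water part `m^{(2)}` at `(q, p)`. -/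
noncomputable def X.water (m : W.X) (i : JetIx) (q p : ℝ) : ℝ := (m.1.2 i).at W.p₀_lt.le q p

variable (W)

/-- The expression for `𝓕₁(λ, m)` at the point `(q, p)` of the air strip. -/
noncomputable def expr₁ (lam : ℝ) (m : W.X) (q p : ℝ) : ℝ :=
  (1 + X.air m .q q p ^ 2) * (X.air m .pp q p + W.H₁pp lam p)
    + X.air m .qq q p * (X.air m .p q p + W.H₁p lam p) ^ 2
    - 2 * X.air m .q q p * (W.H₁p lam p + X.air m .p q p) * X.air m .qp q p
    + W.γ (-p) * (W.H₁p lam p + X.air m .p q p) ^ 3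

/-- The expression for `𝓕₂(λ, m)` at the point `(q, p)` of the water strip. -/
noncomputable def expr₂ (lam : ℝ) (m : W.X) (q p : ℝ) : ℝ :=
  (1 + X.water m .q q p ^ 2) * (X.water m .pp q p + W.H₂pp lam p)
    + X.water m .qq q p * (X.water m .p q p + W.H₂p lam p) ^ 2
    - 2 * X.water m .q q p * (W.H₂p lam p + X.water m .p q p) * X.water m .qp q p

/-- The expression for `𝓕₃(λ, m)` at the point `(q, p₁)` of the interface. The traces of `m`,
`m_q` and `m_qq` from both sides coincide. -/
noncomputable def expr₃ (lam : ℝ) (m : W.X) (q : ℝ) : ℝ :=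
  -((1 + X.air m .q q W.p₁ ^ 2) / (W.H₁p lam W.p₁ + X.air m .p q W.p₁) ^ 2
      - (1 + X.water m .q q W.p₁ ^ 2) / (W.H₂p lam W.p₁ + X.water m .p q W.p₁) ^ 2)
    - 2 * W.g * W.ρJump * (X.air m .o q W.p₁ + W.H₁ lam W.p₁) + W.Q lam
    - W.σ * X.air m .qq q W.p₁ / (1 + X.air m .q q W.p₁ ^ 2) ^ (3 / 2 : ℝ)

/-- The expression for `𝓕₄(λ, m)` at the point `(q, 0)` of the lid. -/
noncomputable def expr₄ (lam : ℝ) (m : W.X) (q : ℝ) : ℝ :=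
  X.air m .o q 0 + W.H₁ lam 0 - W.ℓ
    - depth (fun s => X.air m .o s W.p₁) - depth (fun _ => W.H₁ lam W.p₁)

/-- `y ∈ Y` has the four expressions as its components. -/
structure IsValue (lam : ℝ) (m : W.X) (y : W.Y) : Prop where
  air : ∀ q, ∀ p ∈ Icc W.p₁ 0, y.1.1.at W.p₁_neg.le q p = W.expr₁ lam m q p
  water : ∀ q, ∀ p ∈ Icc W.p₀ W.p₁, y.2.1.1.at W.p₀_lt.le q p = W.expr₂ lam m q p
  interface : ∀ q, y.2.2.1.1 q = W.expr₃ lam m q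
  lid : ∀ q, y.2.2.2.1 0 q = W.expr₄ lam m q

/-- The set on which `h = H + m` has no stagnation: `inf (m_p + H_p) > 0`. -/
def noStagnation (lam : ℝ) : Set W.X :=
  {m | ∃ δ > 0, (∀ q, ∀ p ∈ Icc W.p₁ 0, δ ≤ X.air m .p q p + W.H₁p lam p) ∧
    ∀ q, ∀ p ∈ Icc W.p₀ W.p₁, δ ≤ X.water m .p q p + W.H₂p lam p}

open Classical in
/-- The nonlinear operator `𝓕`: the element of `Y` with the four expressions as its components.
It is only of interest for `λ > 0` and `m` without stagnation; where the expressions do not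
define an element of `Y`, the value is `0` by convention. -/
noncomputable def F (lam : ℝ) (m : W.X) : W.Y :=
  if h : ∃ y, W.IsValue lam m y then h.choose else 0

/-- The Fréchet derivative `𝓕_m(λ, 0)`. -/
noncomputable def Fm (lam : ℝ) : W.X →L[ℝ] W.Y := fderiv ℝ (W.F lam) 0

/-- The mixed derivative `𝓕_{λm}(λ, 0)`. -/
noncomputable def Flm (lam : ℝ) : W.X →L[ℝ] W.Y := deriv W.Fm lam

/-- `M` solves the mode equation with wave number `n`: with `a = Γ` in the air and `a = λ` in
the water, `-(a³ M_p)_p = -n² a M` off the interface, `2⟦a³ M_p⟧ - 2g⟦ρ⟧M = -n² σ M` at `p = p₁`,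
and `M = 0` at `p = p₀` and at `p = 0`. -/
structure SolvesMode (n : ℕ) (lam : ℝ) (M : ℝ → ℝ) : Prop where
  diff_air : DifferentiableOn ℝ M (Icc W.p₁ 0)
  diff_water : DifferentiableOn ℝ M (Icc W.p₀ W.p₁)
  air : ∀ p ∈ Ioo W.p₁ 0,
    HasDerivAt (fun s => W.Γ s ^ 3 * deriv M s) ((n : ℝ) ^ 2 * W.Γ p * M p) p
  water : ∀ p ∈ Ioo W.p₀ W.p₁,
    HasDerivAt (fun s => lam ^ 3 * deriv M s) ((n : ℝ) ^ 2 * lam * M p) p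
  jump : 2 * (W.Γ W.p₁ ^ 3 * derivWithin M (Icc W.p₁ 0) W.p₁
      - lam ^ 3 * derivWithin M (Icc W.p₀ W.p₁) W.p₁) - 2 * W.g * W.ρJump * M W.p₁
    = -(n : ℝ) ^ 2 * W.σ * M W.p₁
  bed : M W.p₀ = 0
  lid : M 0 = 0

/-- `φ ∈ X` is the function `φ(q, p) = M(p) cos q`. -/
def IsCosMode (M : ℝ → ℝ) (φ : W.X) : Prop :=
  (∀ q, ∀ p ∈ Icc W.p₁ 0, X.air φ .o q p = M p * Real.cos q) ∧
    ∀ q, ∀ p ∈ Icc W.p₀ W.p₁, X.water φ .o q p = M p * Real.cos q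

/-- The pairing `∬_{D₁} a³ A₁ φ + ∬_{D₂} a³ A₂ φ + ½ ∫_I A₃ φ + ∫_T a³ A₄ φ_p` of `A ∈ Y` with
`φ ∈ X`, over one period. -/
noncomputable def pairing (lam : ℝ) (A : W.Y) (φ : W.X) : ℝ :=
  (∫ q in (0 : ℝ)..(2 * Real.pi), ∫ p in W.p₁..0,
      W.Γ p ^ 3 * A.1.1.at W.p₁_neg.le q p * X.air φ .o q p)
    + (∫ q in (0 : ℝ)..(2 * Real.pi), ∫ p in W.p₀..W.p₁,
      lam ^ 3 * A.2.1.1.at W.p₀_lt.le q p * X.water φ .o q p)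
    + 1 / 2 * (∫ q in (0 : ℝ)..(2 * Real.pi), A.2.2.1.1 q * X.air φ .o q W.p₁)
    + ∫ q in (0 : ℝ)..(2 * Real.pi), W.Γ 0 ^ 3 * A.2.2.2.1 0 q * X.air φ .p q 0

end WindWave

/-! The Hölder space is a normed algebra, and the components of `F` are polynomials in the
derivatives of m, up to superposition with two scalar functions on the interface. At m = 0 the
arguments of these functions are constants, and superposition is differentiable there
(`hasFDerivAt_superpose`). Product and chain rules then give the linearization as A + λ⁻² B - 2λ³ C
with fixed bounded operators A, B, C (`Fm_eq`). Hence differentiability in λ in operator norm is a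
scalar matter, and only m_qq in the water and the water trace of m_p on the interface enter the
mixed derivative.

The pairing annihilates the range because the linearized problem is formally self-adjoint with
weight a³: multiplied by a³, the bulk operator is (a³ m_p)_p + a m_qq. Green's identity against φ in
each strip (`integral_green`) leaves boundary terms. Those on the bed vanish; those on the interface
combine with half of the third component, through the jump condition for φ, into a multiple of (m_qq
+ m) φ, whose integral over a period is zero; those on the lid cancel against the fourth component,
up to the depth term, a multiple of the integral of cos q (`pairing_Fm`).

For the mixed derivative the water contributes 2∬φ², and the interface contributes -3λ² ∫ φ_p φ. The
energy identity of the mode in the water (`integral_energy`) turns the latter into -3∬φ² - 3λ² ∬φ_p²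
(`pairing_Flm`). The sum is strictly negative, since a mode vanishing in the water has zero energy
in the air and so vanishes everywhere (`exists_water_ne_zero`). A negative value is incompatible
with membership in the range. -/

/-! ### Hölder spaces as normed algebras, and superposition operators. -/

theorem HolderWith.of_abs_sub_le {K : Type*} [PseudoMetricSpace K] {C r : ℝ≥0} {f : K → ℝ}
    (h : ∀ x y, |f x - f y| ≤ C * dist x y ^ (r : ℝ)) : HolderWith C r f := by
  intro x y
  rw [edist_nndist, edist_nndist, ← ENNReal.coe_rpow_of_nonneg _ r.coe_nonneg,
    ← ENNReal.coe_mul, ENNReal.coe_le_coe, ← NNReal.coe_le_coe]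
  simpa [Real.dist_eq] using h x y

namespace HolderSpace

variable {α : ℝ≥0} {K K' : Type} [MetricSpace K] [MetricSpace K']

theorem ext {f g : HolderSpace α K} (h : ∀ x, f x = g x) : f = g :=
  toBCF_injective (BoundedContinuousFunction.ext h)

@[simp] theorem eval_add (f g : HolderSpace α K) (x : K) : (f + g) x = f x + g x := rfl

@[simp] theorem eval_smul (c : ℝ) (f : HolderSpace α K) (x : K) : (c • f) x = c * f x := rfl

@[simp] theorem eval_zero (x : K) : (0 : HolderSpace α K) x = 0 := rfl

@[simp] theorem eval_neg (f : HolderSpace α K) (x : K) : (-f) x = -f x := rfl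

@[simp] theorem eval_sub (f g : HolderSpace α K) (x : K) : (f - g) x = f x - g x := rfl

theorem continuous (f : HolderSpace α K) : Continuous f := f.toBCF.continuous

theorem norm_toBCF_le (f : HolderSpace α K) : ‖f.toBCF‖ ≤ ‖f‖ := by
  rw [norm_def]
  linarith [(nnHolderNorm α (f : K → ℝ)).coe_nonneg]

theorem abs_apply_le (f : HolderSpace α K) (x : K) : |f x| ≤ ‖f‖ :=
  (f.toBCF.norm_coe_le_norm x).trans f.norm_toBCF_le

theorem abs_sub_le (f : HolderSpace α K) (x y : K) :
    |f x - f y| ≤ nnHolderNorm α (f : K → ℝ) * dist x y ^ (α : ℝ) := by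
  simpa [Real.dist_eq] using f.memHolder.holderWith.dist_le x y

/-- A function with a uniform bound and a Hölder constant, as an element of the Hölder space. -/
theorem exists_of_bound (f : K → ℝ) (hf : Continuous f) {A : ℝ} {C : ℝ≥0} (hA : 0 ≤ A)
    (hb : ∀ x, |f x| ≤ A) (h : ∀ x y, |f x - f y| ≤ C * dist x y ^ (α : ℝ)) :
    ∃ g : HolderSpace α K, (∀ x, g x = f x) ∧ ‖g‖ ≤ A + C := by
  have hC : HolderWith C α f := .of_abs_sub_le h
  let g : HolderSpace α K := ⟨BoundedContinuousFunction.ofNormedAddCommGroup f hf A hb, hC.memHolder⟩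
  refine ⟨g, fun x => rfl, ?_⟩
  rw [norm_def]
  have h1 : ‖g.toBCF‖ ≤ A := BoundedContinuousFunction.norm_ofNormedAddCommGroup_le hf hA hb
  have h2 : (nnHolderNorm α (g : K → ℝ) : ℝ) ≤ C := by exact_mod_cast hC.nnholderNorm_le
  linarith

theorem norm_le_of_bound (g : HolderSpace α K) {A : ℝ} {C : ℝ≥0} (hA : 0 ≤ A)
    (hb : ∀ x, |g x| ≤ A) (h : ∀ x y, |g x - g y| ≤ C * dist x y ^ (α : ℝ)) : ‖g‖ ≤ A + C := by
  obtain ⟨g', h1, h2⟩ := exists_of_bound g g.continuous hA hb h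
  rwa [ext h1] at h2

/-- The Leibniz splitting of a difference of products. The constant is kept in this form because,
with the product of the sup norms added, it is dominated by the product of the full norms. -/
theorem abs_mul_sub_mul_le (f g : HolderSpace α K) (x y : K) :
    |f x * g x - f y * g y| ≤
      (‖f.toBCF‖₊ * nnHolderNorm α (g : K → ℝ) + nnHolderNorm α (f : K → ℝ) * ‖g.toBCF‖₊ : ℝ≥0)
        * dist x y ^ (α : ℝ) := by
  have e : f x * g x - f y * g y = f x * (g x - g y) + (f x - f y) * g y := by ring
  have h1 : |f x| ≤ ‖f.toBCF‖ := f.toBCF.norm_coe_le_norm x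
  have h2 : |g y| ≤ ‖g.toBCF‖ := g.toBCF.norm_coe_le_norm y
  have h3 := f.abs_sub_le x y
  have h4 := g.abs_sub_le x y
  push_cast
  rw [e]
  calc _ ≤ |f x| * |g x - g y| + |f x - f y| * |g y| := by
        rw [← abs_mul, ← abs_mul]; exact abs_add_le _ _
    _ ≤ ‖f.toBCF‖ * (nnHolderNorm α (g : K → ℝ) * dist x y ^ (α : ℝ))
        + nnHolderNorm α (f : K → ℝ) * dist x y ^ (α : ℝ) * ‖g.toBCF‖ := by gcongr
    _ = _ := by ring

instance : Mul (HolderSpace α K) :=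
  ⟨fun f g => ⟨f.toBCF * g.toBCF, (HolderWith.of_abs_sub_le (abs_mul_sub_mul_le f g)).memHolder⟩⟩

instance : One (HolderSpace α K) := ⟨⟨1, memHolder_const⟩⟩

@[simp] theorem eval_mul (f g : HolderSpace α K) (x : K) : (f * g) x = f x * g x := rfl

@[simp] theorem eval_one (x : K) : (1 : HolderSpace α K) x = 1 := rfl

noncomputable instance instCommRing : CommRing (HolderSpace α K) :=
  { (inferInstance : AddCommGroup (HolderSpace α K)) with
    mul := (· * ·)
    one := 1
    left_distrib := fun f g h => ext fun x => by simp [mul_add]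
    right_distrib := fun f g h => ext fun x => by simp [add_mul]
    zero_mul := fun f => ext fun x => by simp
    mul_zero := fun f => ext fun x => by simp
    mul_assoc := fun f g h => ext fun x => by simp [mul_assoc]
    one_mul := fun f => ext fun x => by simp
    mul_one := fun f => ext fun x => by simp
    mul_comm := fun f g => ext fun x => by simp [mul_comm] }

/-- The norm and the additive structure are those already in place, so derivatives found by the
product rule are derivatives in the norm of the statement. -/
noncomputable instance instNormedCommRing : NormedCommRing (HolderSpace α K) :=
  { (inferInstance : NormedAddCommGroup (HolderSpace α K)),
    (inferInstance : CommRing (HolderSpace α K)) with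
    norm_mul_le := fun f g => by
      have h := (f * g).norm_le_of_bound (A := ‖f.toBCF‖ * ‖g.toBCF‖) (by positivity)
        (fun x => by
          rw [eval_mul, abs_mul]
          exact mul_le_mul (f.toBCF.norm_coe_le_norm x) (g.toBCF.norm_coe_le_norm x)
            (abs_nonneg _) (norm_nonneg _)) (abs_mul_sub_mul_le f g)
      refine h.trans ?_
      rw [norm_def, norm_def]
      push_cast
      have h1 := (nnHolderNorm α (f : K → ℝ)).coe_nonneg
      have h2 := (nnHolderNorm α (g : K → ℝ)).coe_nonneg
      -- The two sides differ exactly by the product of the two seminorms.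
      nlinarith [mul_nonneg h1 h2] }

noncomputable instance instNormedAlgebra : NormedAlgebra ℝ (HolderSpace α K) :=
  { Algebra.ofModule (R := ℝ) (A := HolderSpace α K)
      (fun c f g => ext fun x => by simp [mul_assoc])
      (fun c f g => ext fun x => by simp [mul_left_comm]) with
    norm_smul_le := fun c f => (norm_smul c f).le }

@[simp] theorem eval_pow (f : HolderSpace α K) (n : ℕ) (x : K) : (f ^ n) x = f x ^ n := by
  induction n with
  | zero => simp
  | succ n ih => rw [pow_succ, eval_mul, ih, pow_succ]

@[simp] theorem eval_two (x : K) : (2 : HolderSpace α K) x = 2 := by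
  rw [← one_add_one_eq_two, eval_add, eval_one]
  norm_num

/-- Precomposition with a map that does not increase distances. -/
noncomputable def compLip (ι : K' → K) (hι : LipschitzWith 1 ι) :
    HolderSpace α K →L[ℝ] HolderSpace α K' :=
  have key (f : HolderSpace α K) (x y : K') :
      |f (ι x) - f (ι y)| ≤ nnHolderNorm α (f : K → ℝ) * dist x y ^ (α : ℝ) :=
    (f.abs_sub_le _ _).trans <| by
      gcongr
      simpa using hι.dist_le_mul x y
  LinearMap.mkContinuous
    { toFun := fun f => ⟨f.toBCF.compContinuous ⟨ι, hι.continuous⟩,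
        (HolderWith.of_abs_sub_le (key f)).memHolder⟩
      map_add' := fun _ _ => rfl
      map_smul' := fun _ _ => rfl } 1 fun f => by
    rw [one_mul, norm_def f]
    exact norm_le_of_bound _ (norm_nonneg _) (fun x => f.toBCF.norm_coe_le_norm _) (key f)

@[simp] theorem compLip_apply (ι : K' → K) (hι : LipschitzWith 1 ι) (f : HolderSpace α K) (x : K') :
    compLip ι hι f x = f (ι x) := rfl

open Classical in
/-- The superposition operator `u ↦ f ∘ u`, with value `0` where `f ∘ u` is not in the space. -/
noncomputable def superpose (f : ℝ → ℝ) (u : HolderSpace α K) : HolderSpace α K :=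
  if h : ∃ g : HolderSpace α K, ∀ x, g x = f (u x) then h.choose else 0

theorem superpose_apply_of_exists {f : ℝ → ℝ} {u : HolderSpace α K}
    (h : ∃ g : HolderSpace α K, ∀ x, g x = f (u x)) (x : K) : superpose f u x = f (u x) := by
  rw [superpose, dif_pos h]
  exact h.choose_spec x

theorem exists_comp_of_lipschitzOnWith {f : ℝ → ℝ} {C : ℝ≥0} {s : Set ℝ}
    (hf : LipschitzOnWith C f s) (u : HolderSpace α K) (hu : ∀ x, u x ∈ s) {A : ℝ} (hA : 0 ≤ A)
    (hb : ∀ x, |f (u x)| ≤ A) :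
    ∃ g : HolderSpace α K, (∀ x, g x = f (u x)) ∧
      ‖g‖ ≤ A + C * nnHolderNorm α (u : K → ℝ) := by
  have := exists_of_bound (α := α) (C := C * nnHolderNorm α (u : K → ℝ)) (fun x => f (u x))
    (hf.continuousOn.comp_continuous u.continuous hu) hA hb fun x y => by
      have h1 := hf.dist_le_mul _ (hu x) _ (hu y)
      rw [Real.dist_eq, Real.dist_eq] at h1
      have h2 := u.abs_sub_le x y
      push_cast
      rw [mul_assoc]
      exact h1.trans (mul_le_mul_of_nonneg_left h2 C.coe_nonneg)
  simpa using this

theorem superpose_apply {f : ℝ → ℝ} {C : ℝ≥0} {s : Set ℝ}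
    (hf : LipschitzOnWith C f s) (u : HolderSpace α K) (hu : ∀ x, u x ∈ s) (x : K) :
    superpose f u x = f (u x) := by
  obtain ⟨g, hg, -⟩ := exists_comp_of_lipschitzOnWith hf u hu
    -- The range of u has diameter at most 2‖u‖, so comparison with the value at the point x bounds
    -- f ∘ u.
    (A := |f (u x)| + C * (2 * ‖u‖)) (by positivity) fun y => by
      have h1 := hf.dist_le_mul _ (hu y) _ (hu x)
      rw [Real.dist_eq, Real.dist_eq] at h1
      have h2 : |u y - u x| ≤ 2 * ‖u‖ := by
        linarith [abs_sub (u y) (u x), u.abs_apply_le x, u.abs_apply_le y]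
      have h3 := mul_le_mul_of_nonneg_left h2 C.coe_nonneg
      linarith [abs_sub_abs_le_abs_sub (f (u y)) (f (u x))]
  exact superpose_apply_of_exists ⟨g, hg⟩ x

/-- The superposition operator is differentiable at constants where `f` is strictly
differentiable. -/
theorem hasFDerivAt_superpose {f : ℝ → ℝ} {f' c : ℝ} (hf : HasStrictDerivAt f f' c) :
    HasFDerivAt (superpose f : HolderSpace α K → HolderSpace α K)
      (f' • ContinuousLinearMap.id ℝ (HolderSpace α K)) (c • 1) := by
  -- Strict differentiability makes the remainder x ↦ f x - f' x Lipschitz near c with an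
  -- arbitrarily small constant. Its differences at two points are thus controlled, as the Hölder
  -- seminorm requires; plain differentiability would control the sup norm only.
  have hloc : ∀ κ : ℝ≥0, 0 < κ → ∃ r > 0,
      LipschitzOnWith κ (fun x => f x - f' * x) (Metric.ball c r) := by
    intro κ hκ
    obtain ⟨s, hs, h⟩ := (hasStrictDerivAt_iff_hasStrictFDerivAt.1 hf).approximates_deriv_on_nhds
      (c := κ) (Or.inr hκ)
    obtain ⟨r, hr, hrs⟩ := Metric.mem_nhds_iff.1 hs
    refine ⟨r, hr, LipschitzOnWith.of_dist_le_mul fun x hx y hy => ?_⟩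
    have := h x (hrs hx) y (hrs hy)
    rw [Real.dist_eq, Real.dist_eq]
    simp only [Real.norm_eq_abs, ContinuousLinearMap.toSpanSingleton_apply, smul_eq_mul] at this
    convert this using 2
    ring
  have hmem : ∀ {r : ℝ} {u : HolderSpace α K}, ‖u - c • 1‖ < r → ∀ x, u x ∈ Metric.ball c r := by
    intro r u hu x
    rw [Metric.mem_ball, Real.dist_eq]
    refine lt_of_le_of_lt ?_ hu
    simpa using (u - c • 1).abs_apply_le x
  -- The choice κ = 1 only serves to make f Lipschitz near c, so that `superpose` takes its true
  -- value there and not the default 0.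
  obtain ⟨r₁, hr₁, h₁⟩ := hloc 1 one_pos
  have hval : ∀ u : HolderSpace α K, ‖u - c • 1‖ < r₁ → ∀ x, superpose f u x = f (u x) := by
    intro u hu x
    have hlip : LipschitzOnWith (1 + ‖f'‖₊) f (Metric.ball c r₁) := by
      have h2 : LipschitzWith ‖f'‖₊ (fun x : ℝ => f' * x) :=
        LipschitzWith.of_dist_le_mul fun x y => by
          rw [Real.dist_eq, Real.dist_eq, ← mul_sub, abs_mul]; rfl
      have := h₁.add (h2.lipschitzOnWith (s := Metric.ball c r₁))
      simpa using this
    exact superpose_apply hlip u (hmem hu) x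
  rw [hasFDerivAt_iff_isLittleO, Asymptotics.isLittleO_iff]
  intro κ hκ
  lift κ to ℝ≥0 using hκ.le
  have hκ' : (0 : ℝ) ≤ κ := κ.coe_nonneg
  obtain ⟨r, hr, h⟩ := hloc κ (by exact_mod_cast hκ)
  filter_upwards [Metric.ball_mem_nhds (c • (1 : HolderSpace α K)) (lt_min hr hr₁)] with u hu
  rw [Metric.mem_ball, dist_eq_norm] at hu
  have hu1 := hu.trans_le (min_le_left _ _)
  have hu2 := hu.trans_le (min_le_right _ _)
  have hc : ∀ x, superpose f (c • (1 : HolderSpace α K)) x = f c := fun x => by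
    rw [hval _ (by simpa using hr₁)]; simp
  have hsub : ∀ x, (superpose f u - superpose f (c • 1) -
      (f' • ContinuousLinearMap.id ℝ (HolderSpace α K)) (u - c • 1) : HolderSpace α K) x =
      (f (u x) - f' * u x) - (f c - f' * c) := fun x => by
    simp [hval u hu2, hc]; ring
  -- The bound κ‖u - c‖ splits into a sup part and a seminorm part, matched separately by the two
  -- estimates of the remainder.
  rw [norm_def (u - c • 1), mul_add]
  refine norm_le_of_bound (α := α) (K := K) _ (A := κ * ‖(u - c • 1 : HolderSpace α K).toBCF‖)
    (C := κ * nnHolderNorm α ((u - c • 1 : HolderSpace α K) : K → ℝ))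
    (by positivity) (fun x => ?_) fun x y => ?_
  · rw [hsub]
    have h3 := h.dist_le_mul _ (hmem hu1 x) _ (Metric.mem_ball_self hr)
    rw [Real.dist_eq, Real.dist_eq] at h3
    refine h3.trans (mul_le_mul_of_nonneg_left ?_ hκ')
    simpa using (u - c • 1 : HolderSpace α K).toBCF.norm_coe_le_norm x
  · rw [hsub, hsub, sub_sub_sub_cancel_right]
    have h3 := h.dist_le_mul _ (hmem hu1 x) _ (hmem hu1 y)
    rw [Real.dist_eq, Real.dist_eq] at h3
    refine h3.trans ?_
    push_cast
    rw [mul_assoc]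
    refine mul_le_mul_of_nonneg_left ?_ hκ'
    simpa using (u - c • 1 : HolderSpace α K).abs_sub_le x y

end HolderSpace

/-! ### Regularity and explicit derivatives of the laminar flow. -/

theorem memHolder_of_hasDerivWithinAt {α : ℝ≥0} (hα : α ≤ 1) {a b : ℝ} {f f' : ℝ → ℝ}
    (hf : ∀ p ∈ Icc a b, HasDerivWithinAt f (f' p) (Icc a b) p) (hf' : ContinuousOn f' (Icc a b)) :
    MemHolder α (fun p : Icc a b => f p) := by
  obtain ⟨C, hC⟩ := isCompact_Icc.exists_bound_of_continuousOn hf'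
  have hlip : LipschitzOnWith C.toNNReal f (Icc a b) :=
    (convex_Icc a b).lipschitzOnWith_of_nnnorm_hasDerivWithin_le hf fun p hp => by
      rw [← NNReal.coe_le_coe]
      exact (hC p hp).trans (Real.le_coe_toNNReal C)
  have h1 : HolderWith C.toNNReal 1 (fun p : Icc a b => f p) :=
    holderWith_one.2 (lipschitzOnWith_iff_restrict.1 hlip)
  exact h1.memHolder.of_le hα

namespace HolderSpace

theorem exists_of_memHolder {α : ℝ≥0} {K : Type} [MetricSpace K] [CompactSpace K] (hα : 0 < α)
    {f : K → ℝ} (hf : MemHolder α f) : ∃ g : HolderSpace α K, ∀ x, g x = f x :=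
  ⟨⟨BoundedContinuousFunction.mkOfCompact ⟨f, hf.holderWith.continuous hα⟩, hf⟩, fun _ => rfl⟩

end HolderSpace

namespace WindWave

variable (W : WindWave)

theorem left_mem_air : W.p₁ ∈ Icc W.p₁ 0 := left_mem_Icc.2 W.p₁_neg.le

theorem right_mem_air : (0 : ℝ) ∈ Icc W.p₁ 0 := right_mem_Icc.2 W.p₁_neg.le

theorem right_mem_water : W.p₁ ∈ Icc W.p₀ W.p₁ := right_mem_Icc.2 W.p₀_lt.le

/-- Only Γ² is assumed differentiable; positivity allows a square root to be taken, giving Γ' = γ/Γ.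
-/
theorem hasDerivWithinAt_Γ {p : ℝ} (hp : p ∈ Icc W.p₁ 0) :
    HasDerivWithinAt W.Γ (W.γ (-p) * (W.Γ p)⁻¹) (Icc W.p₁ 0) p := by
  have h0 := W.Γ_pos p hp
  have h := (W.Γ_deriv p hp).sqrt (by positivity)
  rw [Real.sqrt_sq h0.le] at h
  refine (h.congr_deriv ?_).congr (fun s hs => ?_) ?_
  · field_simp
  · rw [Real.sqrt_sq (W.Γ_pos s hs).le]
  · rw [Real.sqrt_sq h0.le]

theorem continuousOn_Γ : ContinuousOn W.Γ (Icc W.p₁ 0) :=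
  fun _ hp => (W.hasDerivWithinAt_Γ hp).continuousWithinAt

theorem continuousOn_invΓ : ContinuousOn (fun p => (W.Γ p)⁻¹) (Icc W.p₁ 0) :=
  W.continuousOn_Γ.inv₀ fun p hp => (W.Γ_pos p hp).ne'

theorem exists_vorticity :
    ∃ c : HolderSpace W.α (Icc W.p₁ 0), ∀ p, c p = W.γ (-p) := by
  let ν : Icc W.p₁ 0 → Icc 0 (-W.p₁) := fun p =>
    ⟨-p, by linarith [p.2.2], by linarith [p.2.1]⟩
  have hν : Isometry ν := Isometry.of_dist_eq fun x y => by
    simp only [ν, Subtype.dist_eq, dist_neg_neg]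
  have h1 : HolderWith 1 1 ν := holderWith_one.2 hν.lipschitz
  have h2 := h1.memHolder.comp W.γ_holder
  rw [mul_one] at h2
  exact HolderSpace.exists_of_memHolder W.α_pos h2

/-- The vorticity strength in the air as a function of `p`. -/
noncomputable def vorticity : HolderSpace W.α (Icc W.p₁ 0) := W.exists_vorticity.choose

@[simp] theorem vorticity_apply (p : Icc W.p₁ 0) : W.vorticity p = W.γ (-p) :=
  W.exists_vorticity.choose_spec p

theorem continuousOn_vorticity : ContinuousOn (fun p => W.γ (-p)) (Icc W.p₁ 0) := by
  rw [continuousOn_iff_continuous_domRestrict]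
  exact W.vorticity.continuous.congr W.vorticity_apply

theorem hasDerivWithinAt_invΓ {p : ℝ} (hp : p ∈ Icc W.p₁ 0) :
    HasDerivWithinAt (fun s => (W.Γ s)⁻¹) (-(W.γ (-p) * (W.Γ p)⁻¹ ^ 3)) (Icc W.p₁ 0) p := by
  have h0 := (W.Γ_pos p hp).ne'
  refine ((W.hasDerivWithinAt_Γ hp).inv h0).congr_deriv ?_
  field_simp

theorem exists_invΓ :
    ∃ b : HolderSpace W.α (Icc W.p₁ 0), ∀ p, b p = (W.Γ p)⁻¹ :=
  HolderSpace.exists_of_memHolder W.α_pos <| memHolder_of_hasDerivWithinAt W.α_lt_one.le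
    (fun _ hp => W.hasDerivWithinAt_invΓ hp)
    (W.continuousOn_vorticity.mul (W.continuousOn_invΓ.pow 3)).neg

/-- The slope `1 / Γ` of the laminar height function in the air. -/
noncomputable def invΓ : HolderSpace W.α (Icc W.p₁ 0) := W.exists_invΓ.choose

@[simp] theorem invΓ_apply (p : Icc W.p₁ 0) : W.invΓ p = (W.Γ p)⁻¹ :=
  W.exists_invΓ.choose_spec p

theorem H₁p_eq (lam : ℝ) {p : ℝ} (hp : p ∈ Icc W.p₁ 0) : W.H₁p lam p = (W.Γ p)⁻¹ := by
  have hle := W.p₁_neg.le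
  -- The integrand is extended by constants to a continuous function on the line, so that the
  -- fundamental theorem of calculus also applies at the end points.
  let G : ℝ → ℝ := fun s => W.invΓ (projIcc W.p₁ 0 hle s)
  have hG : Continuous G := W.invΓ.continuous.comp continuous_projIcc
  have hGe : ∀ s ∈ Icc W.p₁ 0, G s = (W.Γ s)⁻¹ := fun s hs => by
    simp only [G, projIcc_of_mem hle hs, invΓ_apply]
  have hH : ∀ s ∈ Icc W.p₁ 0, W.H₁ lam s = (∫ x in W.p₁..s, G x) + (W.p₁ - W.p₀) / lam := by
    intro s hs
    rw [H₁]
    congr 1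
    refine intervalIntegral.integral_congr fun x hx => (hGe x ?_).symm
    rw [uIcc_of_le hs.1] at hx
    exact ⟨hx.1, hx.2.trans hs.2⟩
  have hd : HasDerivWithinAt (W.H₁ lam) (G p) (Icc W.p₁ 0) p :=
    (((hG.integral_hasStrictDerivAt W.p₁ p).hasDerivAt.add_const
      ((W.p₁ - W.p₀) / lam)).hasDerivWithinAt).congr hH (hH p hp)
  rw [H₁p, hd.derivWithin (uniqueDiffOn_Icc W.p₁_neg p hp), hGe p hp]

theorem H₁pp_eq (lam : ℝ) {p : ℝ} (hp : p ∈ Icc W.p₁ 0) :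
    W.H₁pp lam p = -(W.γ (-p) * (W.Γ p)⁻¹ ^ 3) :=
  ((W.hasDerivWithinAt_invΓ hp).congr (fun _ hs => W.H₁p_eq lam hs)
    (W.H₁p_eq lam hp)).derivWithin (uniqueDiffOn_Icc W.p₁_neg p hp)

theorem H₂p_eq (lam : ℝ) {p : ℝ} (hp : p ∈ Icc W.p₀ W.p₁) : W.H₂p lam p = lam⁻¹ := by
  have h : HasDerivAt (W.H₂ lam) (1 / lam) p := ((hasDerivAt_id p).sub_const W.p₀).div_const lam
  rw [H₂p, h.hasDerivWithinAt.derivWithin (uniqueDiffOn_Icc W.p₀_lt p hp), one_div]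

theorem H₂pp_eq (lam : ℝ) {p : ℝ} (hp : p ∈ Icc W.p₀ W.p₁) : W.H₂pp lam p = 0 :=
  ((hasDerivWithinAt_const p (Icc W.p₀ W.p₁) lam⁻¹).congr (fun _ hs => W.H₂p_eq lam hs)
    (W.H₂p_eq lam hp)).derivWithin (uniqueDiffOn_Icc W.p₀_lt p hp)

theorem H₁_interface (lam : ℝ) : W.H₁ lam W.p₁ = (W.p₁ - W.p₀) / lam := by
  simp [H₁]

theorem H₁_lid (lam : ℝ) : W.H₁ lam 0 = W.ℓ + (W.p₁ - W.p₀) / lam := by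
  rw [H₁, W.Γ_lid]

theorem depth_const (c : ℝ) : depth (fun _ => c) = c := by
  rw [depth, intervalIntegral.integral_const, smul_eq_mul]
  field_simp
  ring

end WindWave

/-! ### Functions on strips: traces, period mean and parity. -/

namespace HolderSpace

variable {α : ℝ≥0} {b t : ℝ}

theorem at_of_mem (f : HolderSpace α (Strip b t)) (h : b ≤ t) (q : ℝ) {p : ℝ} (hp : p ∈ Icc b t) :
    f.at h q p = f (q, ⟨p, hp⟩) := by
  rw [HolderSpace.at, projIcc_of_mem h hp]

theorem at_coe (f : HolderSpace α (Strip b t)) (h : b ≤ t) (q : ℝ) (p : Icc b t) :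
    f.at h q p = f (q, p) := f.at_of_mem h q p.2

theorem continuous_at (f : HolderSpace α (Strip b t)) (h : b ≤ t) :
    Continuous fun x : ℝ × ℝ => f.at h x.1 x.2 :=
  f.continuous.comp (continuous_fst.prodMk (continuous_projIcc.comp continuous_snd))

/-- A function of the vertical variable as a function on the strip. -/
noncomputable def liftStrip : HolderSpace α (Icc b t) →L[ℝ] HolderSpace α (Strip b t) :=
  compLip Prod.snd LipschitzWith.prod_snd

@[simp] theorem liftStrip_apply (f : HolderSpace α (Icc b t)) (x : Strip b t) :
    liftStrip f x = f x.2 := rfl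

/-- The restriction of a function on the strip to a horizontal line. -/
noncomputable def trace (p : Icc b t) : HolderSpace α (Strip b t) →L[ℝ] HolderSpace α ℝ :=
  compLip (fun q => (q, p)) (LipschitzWith.prodMk_right p)

@[simp] theorem trace_apply (p : Icc b t) (f : HolderSpace α (Strip b t)) (q : ℝ) :
    trace p f q = f (q, p) := rfl

/-- The mean value over a period. -/
noncomputable def mean : HolderSpace α ℝ →L[ℝ] ℝ :=
  LinearMap.mkContinuous
    { toFun := fun f => WindWave.depth f
      map_add' := fun f g => by
        simp only [WindWave.depth, eval_add]
        rw [intervalIntegral.integral_add (f.continuous.intervalIntegrable _ _)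
          (g.continuous.intervalIntegrable _ _), mul_add]
      map_smul' := fun c f => by
        simp only [WindWave.depth, eval_smul, intervalIntegral.integral_const_mul,
          RingHom.id_apply, smul_eq_mul]
        ring } 1 fun f => by
    have h := intervalIntegral.norm_integral_le_of_norm_le_const (a := -Real.pi) (b := Real.pi)
      (f := f) (C := ‖f‖) fun x _ => f.abs_apply_le x
    have hpi := Real.pi_pos
    rw [show Real.pi - -Real.pi = 2 * Real.pi by ring, abs_of_pos (by positivity)] at h
    change ‖1 / (2 * Real.pi) * ∫ q in (-Real.pi)..Real.pi, f q‖ ≤ _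
    rw [norm_mul, Real.norm_of_nonneg (by positivity), one_mul, one_div_mul_eq_div,
      div_le_iff₀ (by positivity)]
    exact h

@[simp] theorem mean_apply (f : HolderSpace α ℝ) : mean f = WindWave.depth f := rfl

end HolderSpace

/-- `2π`-periodic, and even (`s = 1`) or odd (`s = -1`) dependence on the horizontal variable. -/
def HasParity {b t : ℝ} (s : ℝ) (f : Strip b t → ℝ) : Prop :=
  ∀ (q : ℝ) (p : Icc b t), f (q + 2 * Real.pi, p) = f (q, p) ∧ f (-q, p) = s * f (q, p)

namespace HasParity

variable {α : ℝ≥0} {b t s : ℝ} {f g : HolderSpace α (Strip b t)}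

/-- Differentiating the reflection identity f(-q) = s f(q) flips the sign. Evenness is imposed on
the function alone, so the parity of its derivatives has to be derived before values can be placed
in `Y`. -/
theorem deriv_fst (h : b ≤ t) (hf : HasParity s f)
    (hfg : ∀ q, ∀ p ∈ Icc b t, HasDerivAt (fun r => f.at h r p) (g.at h q p) q) :
    HasParity (-s) g := by
  intro q p
  have h1 := hfg q p p.2
  have h2 := (hfg (q + 2 * Real.pi) p p.2).comp_add_const q (2 * Real.pi)
  have h3 := (hfg (-q) p p.2).scomp q (hasDerivAt_neg q)
  simp only [HolderSpace.at_coe, (hf _ _).1] at h1 h2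
  have e : (fun r => f (r, p)) ∘ Neg.neg = fun r => s * f (r, p) := funext fun r => (hf r p).2
  simp only [HolderSpace.at_coe, e] at h3
  refine ⟨h2.unique h1, ?_⟩
  have := h3.unique (h1.const_mul s)
  simp only [smul_eq_mul] at this
  linarith

theorem deriv_snd (h : b < t) (hf : HasParity s f)
    (hfg : ∀ q, ∀ p ∈ Icc b t, HasDerivWithinAt (fun r => f.at h.le q r) (g.at h.le q p)
      (Icc b t) p) :
    HasParity s g := by
  intro q p
  have hu := uniqueDiffOn_Icc h p p.2
  have h1 := hfg q p p.2
  have e1 : (fun r => f.at h.le (q + 2 * Real.pi) r) = fun r => f.at h.le q r :=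
    funext fun r => (hf q _).1
  have e2 : (fun r => f.at h.le (-q) r) = fun r => s * f.at h.le q r :=
    funext fun r => (hf q _).2
  have h2 := hfg (q + 2 * Real.pi) p p.2
  have h3 := hfg (-q) p p.2
  rw [e1] at h2
  rw [e2] at h3
  have h4 := hu.eq_deriv _ h2 h1
  have h5 := hu.eq_deriv _ h3 (h1.const_mul s)
  simp only [HolderSpace.at_coe] at h4 h5
  exact ⟨h4, h5⟩

end HasParity

/-- The parity of the derivative with a given label of an even function. -/
def JetIx.parity : JetIx → ℝ
  | .q | .qp => -1
  | _ => 1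

theorem hasParity_of_mem_stripC2 {α : ℝ≥0} {b t : ℝ} (h : b < t)
    {u : JetIx → HolderSpace α (Strip b t)} (hu : u ∈ stripC2 α h.le) (i : JetIx) :
    HasParity i.parity (u i) := by
  obtain ⟨hj, he⟩ := hu
  have ho : HasParity 1 (u .o) := fun q p => ⟨(he q p).1, by rw [(he q p).2, one_mul]⟩
  have hq : HasParity (-1) (u .q) := ho.deriv_fst h.le hj.q
  have hp : HasParity 1 (u .p) := ho.deriv_snd h hj.p
  cases i with
  | o => exact ho
  | q => exact hq
  | p => exact hp
  | qq => simpa [JetIx.parity] using hq.deriv_fst h.le hj.qq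
  | qp => exact hq.deriv_snd h hj.qp
  | pp => exact hp.deriv_snd h hj.pp

/-- The subspace carries the restricted norm, so the remainder estimate is the same. This lets the
components be differentiated in the ambient Hölder algebras. -/
theorem Submodule.hasFDerivAt_of_subtype {E G : Type*} [NormedAddCommGroup E] [NormedSpace ℝ E]
    [NormedAddCommGroup G] [NormedSpace ℝ G] {S : Submodule ℝ G} {f : E → S} {f' : E →L[ℝ] S}
    {x : E} (h : HasFDerivAt (fun y => (f y : G)) (S.subtypeL.comp f') x) :
    HasFDerivAt f f' x := by
  rw [hasFDerivAt_iff_isLittleO] at h ⊢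
  refine Asymptotics.IsLittleO.of_norm_left ?_
  exact h.norm_left

/-! ### The nonlinear operator written in the Hölder algebras. -/

namespace WindWave

variable (W : WindWave)

open HolderSpace

/-- The derivative of the air part with a given label. -/
noncomputable def airJet (i : JetIx) : W.X →L[ℝ] HolderSpace W.α (Strip W.p₁ 0) :=
  (ContinuousLinearMap.proj i).comp ((ContinuousLinearMap.fst ℝ _ _).comp W.X.subtypeL)

/-- The derivative of the water part with a given label. -/
noncomputable def waterJet (i : JetIx) : W.X →L[ℝ] HolderSpace W.α (Strip W.p₀ W.p₁) :=
  (ContinuousLinearMap.proj i).comp ((ContinuousLinearMap.snd ℝ _ _).comp W.X.subtypeL)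

/-- The trace of a derivative of the air part on the interface. -/
noncomputable def airTrace (i : JetIx) : W.X →L[ℝ] HolderSpace W.α ℝ :=
  (trace ⟨W.p₁, W.left_mem_air⟩).comp (W.airJet i)

/-- The trace of a derivative of the water part on the interface. -/
noncomputable def waterTrace (i : JetIx) : W.X →L[ℝ] HolderSpace W.α ℝ :=
  (trace ⟨W.p₁, W.right_mem_water⟩).comp (W.waterJet i)

/-- The trace of a derivative of the air part on the lid. -/
noncomputable def lidTrace (i : JetIx) : W.X →L[ℝ] HolderSpace W.α ℝ :=
  (trace ⟨0, W.right_mem_air⟩).comp (W.airJet i)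

variable {W}

theorem airJet_apply (m : W.X) (i : JetIx) (q : ℝ) (p : Icc W.p₁ 0) :
    W.airJet i m (q, p) = X.air m i q p := (at_coe _ _ _ _).symm

theorem waterJet_apply (m : W.X) (i : JetIx) (q : ℝ) (p : Icc W.p₀ W.p₁) :
    W.waterJet i m (q, p) = X.water m i q p := (at_coe _ _ _ _).symm

theorem airTrace_apply (m : W.X) (i : JetIx) (q : ℝ) :
    W.airTrace i m q = X.air m i q W.p₁ := airJet_apply m i q _

theorem waterTrace_apply (m : W.X) (i : JetIx) (q : ℝ) :
    W.waterTrace i m q = X.water m i q W.p₁ := waterJet_apply m i q _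

theorem lidTrace_apply (m : W.X) (i : JetIx) (q : ℝ) :
    W.lidTrace i m q = X.air m i q 0 := airJet_apply m i q _

theorem airJet_hasParity (m : W.X) (i : JetIx) : HasParity i.parity (W.airJet i m) :=
  hasParity_of_mem_stripC2 W.p₁_neg m.2.1 i

theorem waterJet_hasParity (m : W.X) (i : JetIx) : HasParity i.parity (W.waterJet i m) :=
  hasParity_of_mem_stripC2 W.p₀_lt m.2.2.1 i

theorem abs_air_le (m : W.X) (i : JetIx) (q p : ℝ) : |X.air m i q p| ≤ ‖m‖ :=
  (abs_apply_le (m.1.1 i) _).trans ((norm_le_pi_norm m.1.1 i).trans (norm_fst_le m.1))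

theorem abs_water_le (m : W.X) (i : JetIx) (q p : ℝ) : |X.water m i q p| ≤ ‖m‖ :=
  (abs_apply_le (m.1.2 i) _).trans ((norm_le_pi_norm m.1.2 i).trans (norm_snd_le m.1))

variable (W)

/-- `F` has a usable formula only on this set, so the derivative at 0 requires it to be a
neighbourhood. The laminar slope has a positive minimum by compactness, and m_p is bounded by ‖m‖.
-/
theorem noStagnation_mem_nhds {lam : ℝ} (hlam : 0 < lam) : W.noStagnation lam ∈ 𝓝 (0 : W.X) := by
  obtain ⟨p, hp, hmin⟩ := isCompact_Icc.exists_isMinOn ⟨_, W.left_mem_air⟩ W.continuousOn_invΓ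
  have hc := inv_pos.2 (W.Γ_pos p hp)
  set c := min (W.Γ p)⁻¹ lam⁻¹ with hcd
  have hc0 : 0 < c := lt_min hc (inv_pos.2 hlam)
  filter_upwards [Metric.ball_mem_nhds (0 : W.X) (half_pos hc0)] with m hm
  rw [mem_ball_zero_iff] at hm
  refine ⟨c / 2, half_pos hc0, fun q s hs => ?_, fun q s hs => ?_⟩
  · have h1 := neg_le_of_abs_le (abs_air_le m .p q s)
    have h2 : (W.Γ p)⁻¹ ≤ (W.Γ s)⁻¹ := hmin hs
    rw [W.H₁p_eq lam hs]
    linarith [min_le_left (W.Γ p)⁻¹ lam⁻¹]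
  · have h1 := neg_le_of_abs_le (abs_water_le m .p q s)
    rw [W.H₂p_eq lam hs]
    linarith [min_le_right (W.Γ p)⁻¹ lam⁻¹]

/-- The first component of the nonlinear operator, in the Hölder algebra of the air strip. -/
noncomputable def airOp (m : W.X) : HolderSpace W.α (Strip W.p₁ 0) :=
  (1 + W.airJet .q m ^ 2) * (W.airJet .pp m - liftStrip W.vorticity * liftStrip W.invΓ ^ 3)
    + W.airJet .qq m * (W.airJet .p m + liftStrip W.invΓ) ^ 2
    - 2 * W.airJet .q m * (liftStrip W.invΓ + W.airJet .p m) * W.airJet .qp m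
    + liftStrip W.vorticity * (liftStrip W.invΓ + W.airJet .p m) ^ 3

/-- The second component of the nonlinear operator, in the Hölder algebra of the water strip. -/
noncomputable def waterOp (lam : ℝ) (m : W.X) : HolderSpace W.α (Strip W.p₀ W.p₁) :=
  (1 + W.waterJet .q m ^ 2) * W.waterJet .pp m
    + W.waterJet .qq m * (W.waterJet .p m + lam⁻¹ • 1) ^ 2
    - 2 * W.waterJet .q m * (lam⁻¹ • 1 + W.waterJet .p m) * W.waterJet .qp m

/-- The third component of the nonlinear operator, in the Hölder algebra of the line. -/
noncomputable def interfaceOp (lam : ℝ) (m : W.X) : HolderSpace W.α ℝ :=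
  -((1 + W.airTrace .q m ^ 2) *
        superpose (fun x => (x ^ 2)⁻¹) ((W.Γ W.p₁)⁻¹ • 1 + W.airTrace .p m)
      - (1 + W.waterTrace .q m ^ 2) *
        superpose (fun x => (x ^ 2)⁻¹) (lam⁻¹ • 1 + W.waterTrace .p m))
    - (2 * W.g * W.ρJump) • (W.airTrace .o m + W.H₁ lam W.p₁ • 1) + W.Q lam • 1
    - W.σ • (W.airTrace .qq m *
        superpose (fun x => ((1 + x) ^ (3 / 2 : ℝ))⁻¹) (W.airTrace .q m ^ 2))

/-- The fourth component of the nonlinear operator, with its derivatives. -/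
noncomputable def lidOp : W.X →L[ℝ] (Fin 3 → HolderSpace W.α ℝ) :=
  ContinuousLinearMap.pi
    ![W.lidTrace .o - (mean.comp (W.airTrace .o)).smulRight (1 : HolderSpace W.α ℝ),
      W.lidTrace .q, W.lidTrace .qq]

variable {W}

/-- The laminar slope in the air is 1/Γ for every λ, so this component does not involve the
parameter. -/
theorem airOp_apply (lam : ℝ) (m : W.X) (q : ℝ) (p : Icc W.p₁ 0) :
    W.airOp m (q, p) = W.expr₁ lam m q p := by
  simp only [airOp, eval_add, eval_sub, eval_mul, eval_pow, eval_one, eval_two, liftStrip_apply,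
    invΓ_apply, vorticity_apply, airJet_apply, expr₁, W.H₁p_eq lam p.2, W.H₁pp_eq lam p.2]
  ring

theorem waterOp_apply (lam : ℝ) (m : W.X) (q : ℝ) (p : Icc W.p₀ W.p₁) :
    W.waterOp lam m (q, p) = W.expr₂ lam m q p := by
  simp only [waterOp, eval_add, eval_sub, eval_mul, eval_pow, eval_one, eval_two, eval_smul,
    waterJet_apply, expr₂, W.H₂p_eq lam p.2, W.H₂pp_eq lam p.2]
  ring

/-- The laminar terms cancel: H(0) = ℓ + (p₁ - p₀)/λ, while ℓ and the mean depth (p₁ - p₀)/λ are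
subtracted. The fourth component is therefore linear in m and independent of λ. -/
theorem lidOp_apply_zero (lam : ℝ) (m : W.X) (q : ℝ) : W.lidOp m 0 q = W.expr₄ lam m q := by
  have h : (⇑(W.airTrace .o m).toBCF) = fun s => X.air m .o s W.p₁ :=
    funext fun s => airTrace_apply m .o s
  simp [lidOp, expr₄, lidTrace_apply, h, depth_const, H₁_lid, H₁_interface]
  ring

end WindWave

/-! ### The two scalar nonlinearities of the interface condition. -/

theorem lipschitzOnWith_inv_sq {δ : ℝ} (hδ : 0 < δ) :
    LipschitzOnWith (2 / δ ^ 3).toNNReal (fun x : ℝ => (x ^ 2)⁻¹) (Ici δ) := by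
  refine (convex_Ici δ).lipschitzOnWith_of_nnnorm_hasDerivWithin_le
    (f' := fun x => -(2 * x) / (x ^ 2) ^ 2) (fun x hx => ?_) fun x hx => ?_
  · have hx0 : 0 < x := hδ.trans_le hx
    simpa using ((hasDerivAt_pow 2 x).fun_inv (by positivity)).hasDerivWithinAt (s := Ici δ)
  · have hx0 : 0 < x := hδ.trans_le hx
    rw [← NNReal.coe_le_coe, Real.coe_toNNReal _ (by positivity), coe_nnnorm, neg_div, norm_neg,
      Real.norm_of_nonneg (by positivity)]
    calc 2 * x / (x ^ 2) ^ 2 = 2 / x ^ 3 := by field_simp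
      _ ≤ 2 / δ ^ 3 := by gcongr; exact hx

theorem hasStrictDerivAt_inv_sq {c : ℝ} (hc : c ≠ 0) :
    HasStrictDerivAt (fun x : ℝ => (x ^ 2)⁻¹) (-2 * c⁻¹ ^ 3) c := by
  refine (HasStrictDerivAt.comp (h := fun x : ℝ => x ^ 2) c
    (hasStrictDerivAt_inv (pow_ne_zero 2 hc)) (hasStrictDerivAt_pow 2 c)).congr_deriv ?_
  field_simp
  norm_num
  ring

theorem hasStrictDerivAt_curvature_factor {x : ℝ} (hx : 0 ≤ x) :
    HasStrictDerivAt (fun x : ℝ => ((1 + x) ^ (3 / 2 : ℝ))⁻¹)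
      (-(3 / 2 * (1 + x) ^ (1 / 2 : ℝ)) / ((1 + x) ^ (3 / 2 : ℝ)) ^ 2) x := by
  have h0 : 0 < 1 + x := by positivity
  have h := (Real.hasStrictDerivAt_rpow_const_of_ne h0.ne' (3 / 2)).comp x
    ((hasStrictDerivAt_id x).const_add 1)
  refine (HasStrictDerivAt.comp (h := fun x : ℝ => (1 + x) ^ (3 / 2 : ℝ)) x
    (hasStrictDerivAt_inv (Real.rpow_pos_of_pos h0 _).ne') h).congr_deriv ?_
  norm_num
  ring

/-- The variable stands for m_q², hence the half-line. The derivative has modulus (3/2)(1 +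
x)^(-5/2), at most 3/2. -/
theorem lipschitzOnWith_curvature_factor :
    LipschitzOnWith (3 / 2) (fun x : ℝ => ((1 + x) ^ (3 / 2 : ℝ))⁻¹) (Ici 0) := by
  refine (convex_Ici 0).lipschitzOnWith_of_nnnorm_hasDerivWithin_le
    (fun x hx => (hasStrictDerivAt_curvature_factor hx).hasDerivAt.hasDerivWithinAt)
    fun x hx => ?_
  have h0 : 1 ≤ 1 + x := by linarith [mem_Ici.1 hx]
  have h1 : 0 < 1 + x := by linarith
  have h2 : ((1 + x) ^ (3 / 2 : ℝ)) ^ 2 = (1 + x) ^ (1 / 2 : ℝ) * (1 + x) ^ (5 / 2 : ℝ) := by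
    rw [← Real.rpow_natCast, ← Real.rpow_mul h1.le, ← Real.rpow_add h1]
    norm_num
  have h3 := Real.rpow_pos_of_pos h1 (1 / 2)
  have h4 : 1 ≤ (1 + x) ^ (5 / 2 : ℝ) := Real.one_le_rpow h0 (by norm_num)
  rw [← NNReal.coe_le_coe, coe_nnnorm, neg_div, norm_neg, Real.norm_of_nonneg (by positivity), h2,
    div_le_iff₀ (by positivity)]
  push_cast
  nlinarith

/-! ### The operator takes values in `Y`. -/

namespace WindWave

open HolderSpace

variable {W : WindWave}

theorem interfaceOp_apply {lam : ℝ} {m : W.X} (hm : m ∈ W.noStagnation lam) (q : ℝ) :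
    W.interfaceOp lam m q = W.expr₃ lam m q := by
  obtain ⟨δ, hδ, ha, hw⟩ := hm
  have h1 : superpose (fun x => (x ^ 2)⁻¹) ((W.Γ W.p₁)⁻¹ • 1 + W.airTrace .p m) q =
      (((W.Γ W.p₁)⁻¹ + X.air m .p q W.p₁) ^ 2)⁻¹ := by
    rw [superpose_apply (lipschitzOnWith_inv_sq hδ)]
    · simp only [eval_add, eval_smul, eval_one, mul_one, airTrace_apply]
    · intro s
      have := ha s _ W.left_mem_air
      rw [W.H₁p_eq lam W.left_mem_air] at this
      simp only [eval_add, eval_smul, eval_one, mul_one, airTrace_apply, mem_Ici]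
      linarith
  have h2 : superpose (fun x => (x ^ 2)⁻¹) (lam⁻¹ • 1 + W.waterTrace .p m) q =
      ((lam⁻¹ + X.water m .p q W.p₁) ^ 2)⁻¹ := by
    rw [superpose_apply (lipschitzOnWith_inv_sq hδ)]
    · simp only [eval_add, eval_smul, eval_one, mul_one, waterTrace_apply]
    · intro s
      have := hw s _ W.right_mem_water
      rw [W.H₂p_eq lam W.right_mem_water] at this
      simp only [eval_add, eval_smul, eval_one, mul_one, waterTrace_apply, mem_Ici]
      linarith
  have h3 : superpose (fun x => ((1 + x) ^ (3 / 2 : ℝ))⁻¹) (W.airTrace .q m ^ 2) q =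
      ((1 + X.air m .q q W.p₁ ^ 2) ^ (3 / 2 : ℝ))⁻¹ := by
    rw [superpose_apply lipschitzOnWith_curvature_factor]
    · simp only [eval_pow, airTrace_apply]
    · intro s
      simp only [eval_pow, mem_Ici]
      positivity
  simp only [interfaceOp, expr₃, eval_add, eval_sub, eval_neg, eval_mul, eval_smul, eval_pow,
    eval_one, h1, h2, h3, airTrace_apply, waterTrace_apply, W.H₁p_eq lam W.left_mem_air,
    W.H₂p_eq lam W.right_mem_water]
  ring

theorem air_add_two_pi (m : W.X) (i : JetIx) (q : ℝ) {p : ℝ} (hp : p ∈ Icc W.p₁ 0) :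
    X.air m i (q + 2 * Real.pi) p = X.air m i q p := by
  have := (airJet_hasParity m i q ⟨p, hp⟩).1
  rwa [airJet_apply, airJet_apply] at this

theorem air_neg (m : W.X) (i : JetIx) (q : ℝ) {p : ℝ} (hp : p ∈ Icc W.p₁ 0) :
    X.air m i (-q) p = i.parity * X.air m i q p := by
  have := (airJet_hasParity m i q ⟨p, hp⟩).2
  rwa [airJet_apply, airJet_apply] at this

theorem water_add_two_pi (m : W.X) (i : JetIx) (q : ℝ) {p : ℝ} (hp : p ∈ Icc W.p₀ W.p₁) :
    X.water m i (q + 2 * Real.pi) p = X.water m i q p := by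
  have := (waterJet_hasParity m i q ⟨p, hp⟩).1
  rwa [waterJet_apply, waterJet_apply] at this

theorem water_neg (m : W.X) (i : JetIx) (q : ℝ) {p : ℝ} (hp : p ∈ Icc W.p₀ W.p₁) :
    X.water m i (-q) p = i.parity * X.water m i q p := by
  have := (waterJet_hasParity m i q ⟨p, hp⟩).2
  rwa [waterJet_apply, waterJet_apply] at this

/-- Each monomial contains an even number of the odd factors m_q and m_qp. -/
theorem airOp_mem (m : W.X) : W.airOp m ∈ stripC0 W.α W.p₁ 0 := by
  intro q p
  -- The parameter value 1 is arbitrary, as the left side does not depend on it.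
  simp only [airOp_apply 1, expr₁, air_add_two_pi m _ q p.2, air_neg m _ q p.2, JetIx.parity]
  exact ⟨trivial, by ring⟩

theorem waterOp_mem (lam : ℝ) (m : W.X) : W.waterOp lam m ∈ stripC0 W.α W.p₀ W.p₁ := by
  intro q p
  simp only [waterOp_apply, expr₂, water_add_two_pi m _ q p.2, water_neg m _ q p.2, JetIx.parity]
  exact ⟨trivial, by ring⟩

theorem interfaceOp_mem {lam : ℝ} {m : W.X} (hm : m ∈ W.noStagnation lam) :
    W.interfaceOp lam m ∈ lineC0 W.α := by
  intro q
  simp only [interfaceOp_apply hm, expr₃, air_add_two_pi m _ q W.left_mem_air,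
    air_neg m _ q W.left_mem_air, water_add_two_pi m _ q W.right_mem_water,
    water_neg m _ q W.right_mem_water, JetIx.parity]
  exact ⟨trivial, by ring_nf⟩

theorem lidOp_mem (m : W.X) : W.lidOp m ∈ lineC2 W.α := by
  have e0 : ∀ q, W.lidOp m 0 q = X.air m .o q 0 - mean (W.airTrace .o m) := fun q => by
    simp [lidOp, lidTrace_apply]
  have e1 : ∀ q, W.lidOp m 1 q = X.air m .q q 0 := fun q => lidTrace_apply m .q q
  have e2 : ∀ q, W.lidOp m 2 q = X.air m .qq q 0 := fun q => lidTrace_apply m .qq q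
  refine ⟨fun q => ?_, fun q => ?_, fun q => ?_⟩
  · rw [e1, show ⇑(W.lidOp m 0).toBCF = _ from funext e0]
    exact (m.2.1.1.q q 0 W.right_mem_air).sub_const _
  · rw [e2, show ⇑(W.lidOp m 1).toBCF = _ from funext e1]
    exact m.2.1.1.qq q 0 W.right_mem_air
  · simp only [e0, air_add_two_pi m _ q W.right_mem_air, air_neg m _ q W.right_mem_air,
      JetIx.parity]
    exact ⟨trivial, by ring⟩

theorem isValue_F {lam : ℝ} {m : W.X} (hm : m ∈ W.noStagnation lam) :
    W.IsValue lam m (W.F lam m) := by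
  have h : ∃ y, W.IsValue lam m y :=
    ⟨(⟨W.airOp m, airOp_mem m⟩, ⟨W.waterOp lam m, waterOp_mem lam m⟩,
      ⟨W.interfaceOp lam m, interfaceOp_mem hm⟩, ⟨W.lidOp m, lidOp_mem m⟩),
      fun q p hp => (at_of_mem _ _ q hp).trans (airOp_apply lam m q ⟨p, hp⟩),
      fun q p hp => (at_of_mem _ _ q hp).trans (waterOp_apply lam m q ⟨p, hp⟩),
      fun q => interfaceOp_apply hm q, fun q => lidOp_apply_zero lam m q⟩
  rw [F, dif_pos h]
  exact h.choose_spec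

theorem F_air {lam : ℝ} {m : W.X} (hm : m ∈ W.noStagnation lam) :
    ((W.F lam m).1 : HolderSpace W.α (Strip W.p₁ 0)) = W.airOp m :=
  ext fun ⟨q, p⟩ => by rw [← at_coe _ W.p₁_neg.le, (isValue_F hm).air q p p.2, airOp_apply lam]

theorem F_water {lam : ℝ} {m : W.X} (hm : m ∈ W.noStagnation lam) :
    ((W.F lam m).2.1 : HolderSpace W.α (Strip W.p₀ W.p₁)) = W.waterOp lam m :=
  ext fun ⟨q, p⟩ => by
    rw [← at_coe _ W.p₀_lt.le, (isValue_F hm).water q p p.2, waterOp_apply lam]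

theorem F_interface {lam : ℝ} {m : W.X} (hm : m ∈ W.noStagnation lam) :
    ((W.F lam m).2.2.1 : HolderSpace W.α ℝ) = W.interfaceOp lam m :=
  ext fun q => by rw [(isValue_F hm).interface q, interfaceOp_apply hm]

/-- `IsValue` prescribes only the function on the lid; uniqueness of derivatives determines the
other two entries. -/
theorem lineC2_ext {α : ℝ≥0} {u v : Fin 3 → HolderSpace α ℝ} (hu : u ∈ lineC2 α)
    (hv : v ∈ lineC2 α) (h : ∀ q, u 0 q = v 0 q) : u = v := by
  have h1 : ∀ q, u 1 q = v 1 q := fun q =>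
    (hu.1 q).unique ((hv.1 q).congr_of_eventuallyEq (.of_forall h))
  have h2 : ∀ q, u 2 q = v 2 q := fun q =>
    (hu.2.1 q).unique ((hv.2.1 q).congr_of_eventuallyEq (.of_forall h1))
  funext i
  fin_cases i
  exacts [ext h, ext h1, ext h2]

theorem F_lid {lam : ℝ} {m : W.X} (hm : m ∈ W.noStagnation lam) :
    ((W.F lam m).2.2.2 : Fin 3 → HolderSpace W.α ℝ) = W.lidOp m :=
  lineC2_ext (W.F lam m).2.2.2.2 (lidOp_mem m) fun q => by
    rw [(isValue_F hm).lid q, lidOp_apply_zero lam]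

end WindWave

/-! ### Linearization at the laminar flow and its dependence on λ. -/

theorem HolderSpace.hasFDerivAt_superpose_comp {α : ℝ≥0} {K : Type} [MetricSpace K] {E : Type*}
    [NormedAddCommGroup E] [NormedSpace ℝ E] {f : ℝ → ℝ} {f' c : ℝ} (hf : HasStrictDerivAt f f' c)
    {u : E → HolderSpace α K} {u' : E →L[ℝ] HolderSpace α K} {x : E} (hu : HasFDerivAt u u' x)
    (hx : u x = c • 1) : HasFDerivAt (fun y => superpose f (u y)) (f' • u') x := by
  have h := hasFDerivAt_superpose (α := α) (K := K) hf
  rw [← hx] at h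
  exact (h.comp x hu).congr_fderiv (by ext1; simp)

namespace WindWave

open HolderSpace

variable (W : WindWave)

/-- The linearization of the first component at the laminar flow. -/
noncomputable def airLin : W.X →L[ℝ] HolderSpace W.α (Strip W.p₁ 0) :=
  W.airJet .pp + (ContinuousLinearMap.mul ℝ _ (liftStrip W.invΓ ^ 2)).comp (W.airJet .qq)
    + (3 : ℝ) • (ContinuousLinearMap.mul ℝ _ (liftStrip W.vorticity * liftStrip W.invΓ ^ 2)).comp
        (W.airJet .p)

/-- The part of the linearized third component that does not depend on the parameter. -/
noncomputable def interfaceLin : W.X →L[ℝ] HolderSpace W.α ℝ :=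
  (2 * W.Γ W.p₁ ^ 3) • W.airTrace .p - (2 * W.g * W.ρJump) • W.airTrace .o
    - W.σ • W.airTrace .qq

theorem hasFDerivAt_airOp : HasFDerivAt W.airOp W.airLin 0 := by
  have h (i) : HasFDerivAt (W.airJet i) (W.airJet i) 0 := (W.airJet i).hasFDerivAt
  refine ((((((h .q).pow 2).const_add 1).mul ((h .pp).sub_const
      (liftStrip W.vorticity * liftStrip W.invΓ ^ 3))).add
      ((h .qq).mul (((h .p).add_const (liftStrip W.invΓ)).pow 2))).sub
      ((((h .q).const_mul 2).mul ((h .p).const_add (liftStrip W.invΓ))).mul (h .qp)) |>.add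
      ((((h .p).const_add (liftStrip W.invΓ)).pow 3).const_mul
        (liftStrip W.vorticity))).congr_fderiv ?_
  ext1 m
  simp [airLin, map_ofNat, Algebra.smul_def]
  ring

theorem hasFDerivAt_waterOp (lam : ℝ) :
    HasFDerivAt (W.waterOp lam) (W.waterJet .pp + (lam⁻¹ ^ 2) • W.waterJet .qq) 0 := by
  have h (i) : HasFDerivAt (W.waterJet i) (W.waterJet i) 0 := (W.waterJet i).hasFDerivAt
  refine ((((((h .q).pow 2).const_add 1).mul (h .pp)).add
      ((h .qq).mul (((h .p).add_const (lam⁻¹ • 1)).pow 2))).sub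
      ((((h .q).const_mul 2).mul ((h .p).const_add (lam⁻¹ • 1))).mul (h .qp))).congr_fderiv ?_
  ext1 m
  simp [Algebra.smul_def, ← map_pow, inv_pow]

theorem hasFDerivAt_interfaceOp {lam : ℝ} (hlam : lam ≠ 0) :
    HasFDerivAt (W.interfaceOp lam) (W.interfaceLin - (2 * lam ^ 3) • W.waterTrace .p) 0 := by
  have ha (i) : HasFDerivAt (W.airTrace i) (W.airTrace i) 0 := (W.airTrace i).hasFDerivAt
  have hw (i) : HasFDerivAt (W.waterTrace i) (W.waterTrace i) 0 := (W.waterTrace i).hasFDerivAt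
  have hΓ : (W.Γ W.p₁)⁻¹ ≠ 0 := inv_ne_zero (W.Γ_pos _ W.left_mem_air).ne'
  have h1 := hasFDerivAt_superpose_comp (hasStrictDerivAt_inv_sq hΓ)
    ((ha .p).const_add ((W.Γ W.p₁)⁻¹ • 1)) (by simp)
  have h2 := hasFDerivAt_superpose_comp (hasStrictDerivAt_inv_sq (inv_ne_zero hlam))
    ((hw .p).const_add (lam⁻¹ • 1)) (by simp)
  have h3 := hasFDerivAt_superpose_comp (hasStrictDerivAt_curvature_factor le_rfl)
    ((ha .q).pow 2) (by simp)
  -- Strict differentiability provides a neighbourhood of c on which f is Lipschitz, which rules out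
  -- the default value of `superpose` at the constant c.
  have hv : ∀ {f : ℝ → ℝ} {f' c : ℝ}, HasStrictDerivAt f f' c →
      superpose f (c • (1 : HolderSpace W.α ℝ)) = f c • 1 := fun hf => by
    obtain ⟨C, s, hs, hC⟩ := hf.hasStrictFDerivAt.exists_lipschitzOnWith
    refine ext fun x => ?_
    rw [superpose_apply hC _ fun x => by simpa using mem_of_mem_nhds hs]
    simp
  have e1 := hv (hasStrictDerivAt_inv_sq hΓ)
  have e2 := hv (hasStrictDerivAt_inv_sq (inv_ne_zero hlam))
  have e3 := hv (hasStrictDerivAt_curvature_factor le_rfl)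
  rw [zero_smul] at e3
  refine ((((((((ha .q).pow 2).const_add 1).mul h1).sub ((((hw .q).pow 2).const_add 1).mul h2)).neg.sub
    (((ha .o).add_const (W.H₁ lam W.p₁ • 1)).const_smul (2 * W.g * W.ρJump))).add_const
      (W.Q lam • 1)).sub (((ha .qq).mul h3).const_smul W.σ)).congr_fderiv ?_
  ext1 m
  refine ext fun q => ?_
  simp [interfaceLin, e1, e2, e3]
  ring

end WindWave

namespace WindWave

open HolderSpace

variable {W : WindWave}

theorem airLin_apply (m : W.X) (q : ℝ) (p : Icc W.p₁ 0) :
    W.airLin m (q, p) = X.air m .pp q p + (W.Γ p)⁻¹ ^ 2 * X.air m .qq q p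
      + 3 * (W.γ (-p) * (W.Γ p)⁻¹ ^ 2 * X.air m .p q p) := by
  simp only [← airJet_apply, ← vorticity_apply, ← invΓ_apply]
  simp [airLin]

theorem interfaceLin_apply (m : W.X) (q : ℝ) :
    W.interfaceLin m q = 2 * W.Γ W.p₁ ^ 3 * X.air m .p q W.p₁
      - 2 * W.g * W.ρJump * X.air m .o q W.p₁ - W.σ * X.air m .qq q W.p₁ := by
  simp [interfaceLin, ← airTrace_apply]

variable (W)

theorem airLin_mem (m : W.X) : W.airLin m ∈ stripC0 W.α W.p₁ 0 := by
  intro q p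
  simp only [airLin_apply, air_add_two_pi m _ q p.2, air_neg m _ q p.2, JetIx.parity]
  exact ⟨trivial, by ring⟩

theorem waterJet_mem {i : JetIx} (hi : i.parity = 1) (m : W.X) :
    W.waterJet i m ∈ stripC0 W.α W.p₀ W.p₁ := by
  intro q p
  have := waterJet_hasParity m i q p
  rwa [hi, one_mul] at this

theorem interfaceLin_mem (m : W.X) : W.interfaceLin m ∈ lineC0 W.α := by
  intro q
  simp only [interfaceLin_apply, air_add_two_pi m _ q W.left_mem_air,
    air_neg m _ q W.left_mem_air, JetIx.parity]
  exact ⟨trivial, by ring⟩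

theorem waterTrace_p_mem (m : W.X) : W.waterTrace .p m ∈ lineC0 W.α := by
  intro q
  simp only [waterTrace_apply, water_add_two_pi m _ q W.right_mem_water,
    water_neg m _ q W.right_mem_water, JetIx.parity]
  exact ⟨trivial, by ring⟩

/-- The part of the linearized operator that does not depend on the parameter. -/
noncomputable def linConst : W.X →L[ℝ] W.Y :=
  (W.airLin.codRestrict _ W.airLin_mem).prod
    (((W.waterJet .pp).codRestrict _ (W.waterJet_mem rfl)).prod
      ((W.interfaceLin.codRestrict _ W.interfaceLin_mem).prod
        (W.lidOp.codRestrict _ lidOp_mem)))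

/-- The coefficient of `λ⁻²` in the linearized operator. -/
noncomputable def linInvSq : W.X →L[ℝ] W.Y :=
  (0 : W.X →L[ℝ] stripC0 W.α W.p₁ 0).prod
    (((W.waterJet .qq).codRestrict _ (W.waterJet_mem rfl)).prod 0)

/-- The coefficient of `-2 λ³` in the linearized operator. -/
noncomputable def linCube : W.X →L[ℝ] W.Y :=
  (0 : W.X →L[ℝ] stripC0 W.α W.p₁ 0).prod
    ((0 : W.X →L[ℝ] stripC0 W.α W.p₀ W.p₁).prod
      (((W.waterTrace .p).codRestrict _ W.waterTrace_p_mem).prod 0))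

/-- The linearized operator. -/
noncomputable def lin (lam : ℝ) : W.X →L[ℝ] W.Y :=
  W.linConst + (lam⁻¹ ^ 2) • W.linInvSq - (2 * lam ^ 3) • W.linCube

/-- The derivative of the linearized operator with respect to the parameter. -/
noncomputable def linDeriv (lam : ℝ) : W.X →L[ℝ] W.Y :=
  (-2 * lam⁻¹ ^ 3) • W.linInvSq - (6 * lam ^ 2) • W.linCube

/-- With fixed vectors A, B, C, only scalar coefficients are differentiated; applied to operators,
this gives differentiability in operator norm. The formula for f is needed for positive x only,
which is a neighbourhood of λ. -/
theorem hasDerivAt_inv_sq_smul_sub_cube_smul {G : Type*} [NormedAddCommGroup G]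
    [NormedSpace ℝ G] (A B C : G) {f : ℝ → G} {lam : ℝ} (hlam : 0 < lam)
    (hf : ∀ x > 0, f x = A + (x⁻¹ ^ 2) • B - (2 * x ^ 3) • C) :
    HasDerivAt f ((-2 * lam⁻¹ ^ 3) • B - (6 * lam ^ 2) • C) lam := by
  have h1 : HasDerivAt (fun x : ℝ => x⁻¹ ^ 2) (-2 * lam⁻¹ ^ 3) lam := by
    simpa using (hasStrictDerivAt_inv_sq hlam.ne').hasDerivAt
  have h2 : HasDerivAt (fun x : ℝ => 2 * x ^ 3) (6 * lam ^ 2) lam :=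
    ((hasDerivAt_pow 3 lam).const_mul 2).congr_deriv (by norm_num; ring)
  refine (((h1.smul_const B).const_add A).sub (h2.smul_const C)).congr_of_eventuallyEq ?_
  filter_upwards [lt_mem_nhds hlam] with x hx using hf x hx

theorem differentiableAt_inv_sq_smul_sub_cube_smul {G : Type*} [NormedAddCommGroup G]
    [NormedSpace ℝ G] (A B C : G) {f : ℝ → G} {lam : ℝ} (hlam : 0 < lam)
    (hf : ∀ x > 0, f x = A + (x⁻¹ ^ 2) • B - (2 * x ^ 3) • C) : DifferentiableAt ℝ f lam :=
  (hasDerivAt_inv_sq_smul_sub_cube_smul A B C hlam hf).differentiableAt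

theorem deriv_inv_sq_smul_sub_cube_smul {G : Type*} [NormedAddCommGroup G]
    [NormedSpace ℝ G] (A B C : G) {f : ℝ → G} {lam : ℝ} (hlam : 0 < lam)
    (hf : ∀ x > 0, f x = A + (x⁻¹ ^ 2) • B - (2 * x ^ 3) • C) :
    deriv f lam = (-2 * lam⁻¹ ^ 3) • B - (6 * lam ^ 2) • C :=
  (hasDerivAt_inv_sq_smul_sub_cube_smul A B C hlam hf).deriv

variable {W} {lam : ℝ}

theorem lin_air (m : W.X) : (W.lin lam m).1.1 = W.airLin m := by
  change W.airLin m + (lam⁻¹ ^ 2) • (0 : HolderSpace W.α (Strip W.p₁ 0)) - (2 * lam ^ 3) • 0 = _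
  simp

theorem lin_water (m : W.X) :
    (W.lin lam m).2.1.1 = W.waterJet .pp m + (lam⁻¹ ^ 2) • W.waterJet .qq m := by
  change W.waterJet .pp m + (lam⁻¹ ^ 2) • W.waterJet .qq m
    - (2 * lam ^ 3) • (0 : HolderSpace W.α (Strip W.p₀ W.p₁)) = _
  simp

theorem lin_interface (m : W.X) :
    (W.lin lam m).2.2.1.1 = W.interfaceLin m - (2 * lam ^ 3) • W.waterTrace .p m := by
  change W.interfaceLin m + (lam⁻¹ ^ 2) • (0 : HolderSpace W.α ℝ)
    - (2 * lam ^ 3) • W.waterTrace .p m = _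
  simp

theorem lin_lid (m : W.X) : (W.lin lam m).2.2.2.1 = W.lidOp m := by
  change W.lidOp m + (lam⁻¹ ^ 2) • (0 : Fin 3 → HolderSpace W.α ℝ) - (2 * lam ^ 3) • 0 = _
  simp

variable (W)

theorem hasFDerivAt_F (hlam : 0 < lam) : HasFDerivAt (W.F lam) (W.lin lam) 0 := by
  have hN := W.noStagnation_mem_nhds hlam
  have h1 : HasFDerivAt (fun m => (W.F lam m).1)
      ((ContinuousLinearMap.fst ℝ _ _).comp (W.lin lam)) 0 :=
    Submodule.hasFDerivAt_of_subtype <| (W.hasFDerivAt_airOp.congr_of_eventuallyEq <| by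
      filter_upwards [hN] with m hm using F_air hm).congr_fderiv <|
        ContinuousLinearMap.ext fun m => (lin_air m).symm
  have h2 : HasFDerivAt (fun m => (W.F lam m).2.1)
      ((ContinuousLinearMap.fst ℝ _ _).comp
        ((ContinuousLinearMap.snd ℝ _ _).comp (W.lin lam))) 0 :=
    Submodule.hasFDerivAt_of_subtype <| ((W.hasFDerivAt_waterOp lam).congr_of_eventuallyEq <| by
      filter_upwards [hN] with m hm using F_water hm).congr_fderiv <|
        ContinuousLinearMap.ext fun m => (lin_water m).symm
  have h3 : HasFDerivAt (fun m => (W.F lam m).2.2.1)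
      ((ContinuousLinearMap.fst ℝ _ _).comp ((ContinuousLinearMap.snd ℝ _ _).comp
        ((ContinuousLinearMap.snd ℝ _ _).comp (W.lin lam)))) 0 :=
    Submodule.hasFDerivAt_of_subtype <|
      ((W.hasFDerivAt_interfaceOp hlam.ne').congr_of_eventuallyEq <| by
        filter_upwards [hN] with m hm using F_interface hm).congr_fderiv <|
          ContinuousLinearMap.ext fun m => (lin_interface m).symm
  have h4 : HasFDerivAt (fun m => (W.F lam m).2.2.2)
      ((ContinuousLinearMap.snd ℝ _ _).comp ((ContinuousLinearMap.snd ℝ _ _).comp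
        ((ContinuousLinearMap.snd ℝ _ _).comp (W.lin lam)))) 0 :=
    Submodule.hasFDerivAt_of_subtype <| (W.lidOp.hasFDerivAt.congr_of_eventuallyEq <| by
      filter_upwards [hN] with m hm using F_lid hm).congr_fderiv <|
        ContinuousLinearMap.ext fun m => (lin_lid m).symm
  exact h1.prodMk (h2.prodMk (h3.prodMk h4))

theorem Fm_eq (hlam : 0 < lam) : W.Fm lam = W.lin lam :=
  (W.hasFDerivAt_F hlam).fderiv

theorem differentiableAt_Fm (hlam : 0 < lam) : DifferentiableAt ℝ W.Fm lam :=
  differentiableAt_inv_sq_smul_sub_cube_smul (G := W.X →L[ℝ] W.Y) W.linConst W.linInvSq W.linCube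
    hlam fun _ hx => W.Fm_eq hx

theorem Flm_eq (hlam : 0 < lam) : W.Flm lam = W.linDeriv lam :=
  deriv_inv_sq_smul_sub_cube_smul (G := W.X →L[ℝ] W.Y) W.linConst W.linInvSq W.linCube hlam
    fun _ hx => W.Fm_eq hx

variable {W}

theorem Fm_air (hlam : 0 < lam) (m : W.X) (q : ℝ) {p : ℝ} (hp : p ∈ Icc W.p₁ 0) :
    (W.Fm lam m).1.1.at W.p₁_neg.le q p = X.air m .pp q p + (W.Γ p)⁻¹ ^ 2 * X.air m .qq q p
      + 3 * (W.γ (-p) * (W.Γ p)⁻¹ ^ 2 * X.air m .p q p) := by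
  rw [at_of_mem _ _ _ hp, ← airLin_apply m q ⟨p, hp⟩, W.Fm_eq hlam, lin_air]

theorem Fm_water (hlam : 0 < lam) (m : W.X) (q p : ℝ) :
    (W.Fm lam m).2.1.1.at W.p₀_lt.le q p =
      X.water m .pp q p + lam⁻¹ ^ 2 * X.water m .qq q p := by
  rw [W.Fm_eq hlam, lin_water]
  rfl

theorem Fm_interface (hlam : 0 < lam) (m : W.X) (q : ℝ) :
    (W.Fm lam m).2.2.1.1 q = 2 * W.Γ W.p₁ ^ 3 * X.air m .p q W.p₁
      - 2 * W.g * W.ρJump * X.air m .o q W.p₁ - W.σ * X.air m .qq q W.p₁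
      - 2 * lam ^ 3 * X.water m .p q W.p₁ := by
  rw [← interfaceLin_apply, ← waterTrace_apply, W.Fm_eq hlam, lin_interface]
  rfl

theorem Fm_lid (hlam : 0 < lam) (m : W.X) (q : ℝ) :
    (W.Fm lam m).2.2.2.1 0 q = X.air m .o q 0 - mean (W.airTrace .o m) := by
  rw [W.Fm_eq hlam, lin_lid]
  simp [lidOp, lidTrace_apply]

theorem Flm_air (hlam : 0 < lam) (m : W.X) : (W.Flm lam m).1.1 = 0 := by
  rw [W.Flm_eq hlam]
  change (-2 * lam⁻¹ ^ 3) • (0 : HolderSpace W.α (Strip W.p₁ 0)) - (6 * lam ^ 2) • 0 = 0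
  simp

theorem Flm_water (hlam : 0 < lam) (m : W.X) (q p : ℝ) :
    (W.Flm lam m).2.1.1.at W.p₀_lt.le q p = -2 * lam⁻¹ ^ 3 * X.water m .qq q p := by
  rw [W.Flm_eq hlam]
  change -2 * lam⁻¹ ^ 3 * X.water m .qq q p - 6 * lam ^ 2 * 0 = _
  ring

theorem Flm_interface (hlam : 0 < lam) (m : W.X) (q : ℝ) :
    (W.Flm lam m).2.2.1.1 q = -(6 * lam ^ 2 * X.water m .p q W.p₁) := by
  rw [← waterTrace_apply, W.Flm_eq hlam]
  change -2 * lam⁻¹ ^ 3 * 0 - 6 * lam ^ 2 * W.waterTrace .p m q = _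
  ring

theorem Flm_lid (hlam : 0 < lam) (m : W.X) : (W.Flm lam m).2.2.2.1 = 0 := by
  rw [W.Flm_eq hlam]
  change (-2 * lam⁻¹ ^ 3) • (0 : Fin 3 → HolderSpace W.α ℝ) - (6 * lam ^ 2) • 0 = 0
  simp

end WindWave

/-! ### Modes on a single strip: energy and Green identities. -/

@[fun_prop]
theorem Continuous.holderSpace_at {α : ℝ≥0} {b t : ℝ} {T : Type*} [TopologicalSpace T]
    (f : HolderSpace α (Strip b t)) (h : b ≤ t) {g k : T → ℝ} (hg : Continuous g)
    (hk : Continuous k) : Continuous fun x => f.at h (g x) (k x) :=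
  (f.continuous_at h).comp (hg.prodMk hk)

theorem eq_zero_of_mem_stripC2 {α : ℝ≥0} {b t : ℝ} (h : b < t)
    {u : JetIx → HolderSpace α (Strip b t)} (hu : u ∈ stripC2 α h.le)
    (h0 : ∀ q, ∀ p ∈ Icc b t, (u .o).at h.le q p = 0) : u = 0 := by
  have hdq {f g : HolderSpace α (Strip b t)}
      (hf : ∀ q, ∀ p ∈ Icc b t, HasDerivAt (fun s => f.at h.le s p) (g.at h.le q p) q)
      (h0 : ∀ q, ∀ p ∈ Icc b t, f.at h.le q p = 0) : ∀ q, ∀ p ∈ Icc b t, g.at h.le q p = 0 :=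
    fun q p hp => (hf q p hp).unique <|
      (hasDerivAt_const q 0).congr_of_eventuallyEq (.of_forall fun s => h0 s p hp)
  have hdp {f g : HolderSpace α (Strip b t)}
      (hf : ∀ q, ∀ p ∈ Icc b t,
        HasDerivWithinAt (fun s => f.at h.le q s) (g.at h.le q p) (Icc b t) p)
      (h0 : ∀ q, ∀ p ∈ Icc b t, f.at h.le q p = 0) : ∀ q, ∀ p ∈ Icc b t, g.at h.le q p = 0 :=
    fun q p hp => (uniqueDiffOn_Icc h p hp).eq_deriv _ (hf q p hp) <|
      (hasDerivWithinAt_const p _ 0).congr (fun s hs => h0 q s hs) (h0 q p hp)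
  have hz : ∀ {f : HolderSpace α (Strip b t)}, (∀ q, ∀ p ∈ Icc b t, f.at h.le q p = 0) → f = 0 :=
    fun hf => HolderSpace.ext fun ⟨q, p⟩ => by
      rw [← HolderSpace.at_coe _ h.le, hf q p p.2, HolderSpace.eval_zero]
  funext i
  cases i with
  | o => exact hz h0
  | q => exact hz (hdq hu.1.q h0)
  | p => exact hz (hdp hu.1.p h0)
  | qq => exact hz (hdq hu.1.qq (hdq hu.1.q h0))
  | qp => exact hz (hdp hu.1.qp (hdq hu.1.q h0))
  | pp => exact hz (hdp hu.1.pp (hdp hu.1.p h0))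

/-- `u = M(p) cos q` on the strip `b ≤ p ≤ t`, where `(a³ M')' = a M`. -/
structure IsStripMode {α : ℝ≥0} {b t : ℝ} (h : b < t) (a a' M : ℝ → ℝ)
    (u : JetIx → HolderSpace α (Strip b t)) : Prop where
  mem : u ∈ stripC2 α h.le
  cont : Continuous a
  cont' : Continuous a'
  hasDeriv : ∀ p ∈ Icc b t, HasDerivWithinAt a (a' p) (Icc b t) p
  diff : DifferentiableOn ℝ M (Icc b t)
  ode : ∀ p ∈ Ioo b t, HasDerivAt (fun s => a s ^ 3 * deriv M s) (a p * M p) p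
  eq : ∀ q, ∀ p ∈ Icc b t, (u .o).at h.le q p = M p * Real.cos q

namespace IsStripMode

variable {α : ℝ≥0} {b t : ℝ} {h : b < t} {a a' M : ℝ → ℝ}
  {u v : JetIx → HolderSpace α (Strip b t)}

theorem p_eq (H : IsStripMode h a a' M u) (q : ℝ) {p : ℝ} (hp : p ∈ Icc b t) :
    (u .p).at h.le q p = derivWithin M (Icc b t) p * Real.cos q :=
  (uniqueDiffOn_Icc h p hp).eq_deriv _ (H.mem.1.p q p hp) <|
    ((H.diff p hp).hasDerivWithinAt.mul_const (Real.cos q)).congr (fun s hs => H.eq q s hs)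
      (H.eq q p hp)

theorem p_eq_zero_mul (H : IsStripMode h a a' M u) (q : ℝ) {p : ℝ} (hp : p ∈ Icc b t) :
    (u .p).at h.le q p = (u .p).at h.le 0 p * Real.cos q := by
  rw [H.p_eq q hp, H.p_eq 0 hp, Real.cos_zero, mul_one]

theorem pp_eq (H : IsStripMode h a a' M u) (q : ℝ) {p : ℝ} (hp : p ∈ Icc b t) :
    (u .pp).at h.le q p = (u .pp).at h.le 0 p * Real.cos q :=
  (uniqueDiffOn_Icc h p hp).eq_deriv _ (H.mem.1.pp q p hp) <|
    ((H.mem.1.pp 0 p hp).mul_const (Real.cos q)).congr (fun _ hs => H.p_eq_zero_mul q hs)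
      (H.p_eq_zero_mul q hp)

theorem q_eq (H : IsStripMode h a a' M u) (q : ℝ) {p : ℝ} (hp : p ∈ Icc b t) :
    (u .q).at h.le q p = M p * -Real.sin q :=
  (H.mem.1.q q p hp).unique <|
    ((Real.hasDerivAt_cos q).const_mul (M p)).congr_of_eventuallyEq
      (.of_forall fun s => H.eq s p hp)

theorem qq_eq (H : IsStripMode h a a' M u) (q : ℝ) {p : ℝ} (hp : p ∈ Icc b t) :
    (u .qq).at h.le q p = -(u .o).at h.le q p := by
  rw [H.eq q p hp, ← mul_neg]
  exact (H.mem.1.qq q p hp).unique <|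
    ((Real.hasDerivAt_sin q).neg.const_mul (M p)).congr_of_eventuallyEq
      (.of_forall fun s => H.q_eq s hp)

theorem hasDerivWithinAt_cube (H : IsStripMode h a a' M u) {p : ℝ} (hp : p ∈ Icc b t) :
    HasDerivWithinAt (fun s => a s ^ 3) (3 * a p ^ 2 * a' p) (Icc b t) p :=
  ((H.hasDeriv p hp).fun_pow 3).congr_deriv (by norm_num)

/-- The mode equation holds up to the boundary of the strip. -/
theorem equation (H : IsStripMode h a a' M u) (q : ℝ) {p : ℝ} (hp : p ∈ Icc b t) :
    a p ^ 3 * (u .pp).at h.le q p + 3 * a p ^ 2 * a' p * (u .p).at h.le q p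
      = a p * (u .o).at h.le q p := by
  have ha := H.cont
  have ha' := H.cont'
  -- The differential equation is available in the open interval only. Membership in C² up to the
  -- boundary makes both sides continuous, so the identity passes to the closure. It is proved at q
  -- = 0, where the cosine is 1, and then multiplied by cos q.
  have key : EqOn (fun p => a p ^ 3 * (u .pp).at h.le 0 p + 3 * a p ^ 2 * a' p * (u .p).at h.le 0 p)
      (fun p => a p * (u .o).at h.le 0 p) (Icc b t) := by
    refine EqOn.of_subset_closure (s := Ioo b t) (fun s hs => ?_) (by fun_prop) (by fun_prop)
      Ioo_subset_Icc_self (closure_Ioo h.ne).ge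
    have hs' := Ioo_subset_Icc_self hs
    have h1 : HasDerivAt (fun s => a s ^ 3 * (u .p).at h.le 0 s)
        (3 * a s ^ 2 * a' s * (u .p).at h.le 0 s + a s ^ 3 * (u .pp).at h.le 0 s) s :=
      ((H.hasDerivWithinAt_cube hs').mul (H.mem.1.pp 0 s hs')).hasDerivAt (Icc_mem_nhds hs.1 hs.2)
    have h2 := h1.unique <| (H.ode s hs).congr_of_eventuallyEq <| by
      filter_upwards [Ioo_mem_nhds hs.1 hs.2] with r hr
      rw [H.p_eq 0 (Ioo_subset_Icc_self hr), Real.cos_zero, mul_one,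
        derivWithin_of_mem_nhds (Icc_mem_nhds hr.1 hr.2)]
    simp only [H.eq 0 s hs', Real.cos_zero, mul_one]
    rw [← h2]
    ring
  have := key hp
  simp only [H.eq 0 p hp, Real.cos_zero, mul_one] at this
  rw [H.pp_eq q hp, H.p_eq_zero_mul q hp, H.eq q p hp]
  linear_combination Real.cos q * this

/-- By the mode equation, the integrand is the p-derivative of a³ u_p u. -/
theorem integral_energy (H : IsStripMode h a a' M u) (q : ℝ) :
    ∫ p in b..t, (a p * (u .o).at h.le q p ^ 2 + a p ^ 3 * (u .p).at h.le q p ^ 2) =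
      a t ^ 3 * (u .p).at h.le q t * (u .o).at h.le q t
        - a b ^ 3 * (u .p).at h.le q b * (u .o).at h.le q b := by
  have ha := H.cont
  refine intervalIntegral.integral_eq_sub_of_hasDerivAt_of_le h.le
    (f := fun p => a p ^ 3 * (u .p).at h.le q p * (u .o).at h.le q p) (by fun_prop)
    (fun p hp => ?_) (Continuous.intervalIntegrable (by fun_prop) _ _)
  have hp' := Ioo_subset_Icc_self hp
  refine ((((H.hasDerivWithinAt_cube hp').mul (H.mem.1.pp q p hp')).mul
    (H.mem.1.p q p hp')).hasDerivAt (Icc_mem_nhds hp.1 hp.2)).congr_deriv ?_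
  simp only [Pi.mul_apply]
  linear_combination (u .o).at h.le q p * H.equation q hp'

/-- The integrand is the derivative of the weighted Wronskian a³ (v_p u - v u_p), again by the mode
equation. -/
theorem integral_green_vertical (H : IsStripMode h a a' M u) (hv : v ∈ stripC2 α h.le) (q : ℝ) :
    ∫ p in b..t, ((a p ^ 3 * (v .pp).at h.le q p + 3 * a p ^ 2 * a' p * (v .p).at h.le q p)
        * (u .o).at h.le q p - a p * (v .o).at h.le q p * (u .o).at h.le q p) =
      a t ^ 3 * ((v .p).at h.le q t * (u .o).at h.le q t - (v .o).at h.le q t * (u .p).at h.le q t)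
        - a b ^ 3 * ((v .p).at h.le q b * (u .o).at h.le q b
          - (v .o).at h.le q b * (u .p).at h.le q b) := by
  have ha := H.cont
  have ha' := H.cont'
  refine intervalIntegral.integral_eq_sub_of_hasDerivAt_of_le h.le
    (f := fun p => a p ^ 3 * ((v .p).at h.le q p * (u .o).at h.le q p
      - (v .o).at h.le q p * (u .p).at h.le q p)) (by fun_prop)
    (fun p hp => ?_) (Continuous.intervalIntegrable (by fun_prop) _ _)
  have hp' := Ioo_subset_Icc_self hp
  refine (((H.hasDerivWithinAt_cube hp').mul (((hv.1.pp q p hp').mul (H.mem.1.p q p hp')).sub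
    ((hv.1.p q p hp').mul (H.mem.1.pp q p hp')))).hasDerivAt
      (Icc_mem_nhds hp.1 hp.2)).congr_deriv ?_
  simp only [Pi.mul_apply, Pi.sub_apply]
  linear_combination -(v .o).at h.le q p * H.equation q hp'

/-- Since u_qq = -u, the integrand is the q-derivative of v_q u - v u_q, which is periodic. -/
theorem integral_green_horizontal (H : IsStripMode h a a' M u) (hv : v ∈ stripC2 α h.le) {p : ℝ}
    (hp : p ∈ Icc b t) :
    ∫ q in (0 : ℝ)..(2 * Real.pi), ((v .qq).at h.le q p * (u .o).at h.le q p
      + (v .o).at h.le q p * (u .o).at h.le q p) = 0 := by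
  have hI := intervalIntegral.integral_eq_sub_of_hasDerivAt
    (f := fun q => (v .q).at h.le q p * (u .o).at h.le q p - (v .o).at h.le q p * (u .q).at h.le q p)
    (f' := fun q => (v .qq).at h.le q p * (u .o).at h.le q p
      + (v .o).at h.le q p * (u .o).at h.le q p) (a := 0) (b := 2 * Real.pi)
    (fun q _ => by
      refine (((hv.1.qq q p hp).mul (H.mem.1.q q p hp)).sub
        ((hv.1.q q p hp).mul (H.mem.1.qq q p hp))).congr_deriv ?_
      rw [H.qq_eq q hp]
      ring) (Continuous.intervalIntegrable (by fun_prop) _ _)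
  rw [hI]
  have hper : ∀ {w : JetIx → HolderSpace α (Strip b t)}, w ∈ stripC2 α h.le → ∀ i,
      (w i).at h.le (2 * Real.pi) p = (w i).at h.le 0 p := fun hw i => by
    have := (hasParity_of_mem_stripC2 h hw i 0 ⟨p, hp⟩).1
    rw [HolderSpace.at_of_mem _ _ _ hp, HolderSpace.at_of_mem _ _ _ hp, ← this, zero_add]
  simp only [hper hv, hper H.mem, sub_self]

/-- Green's identity on the strip, for a mode and an arbitrary function. -/
theorem integral_green (H : IsStripMode h a a' M u) (hv : v ∈ stripC2 α h.le) :
    ∫ q in (0 : ℝ)..(2 * Real.pi), ∫ p in b..t,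
      (a p ^ 3 * (v .pp).at h.le q p + 3 * a p ^ 2 * a' p * (v .p).at h.le q p
        + a p * (v .qq).at h.le q p) * (u .o).at h.le q p =
    ∫ q in (0 : ℝ)..(2 * Real.pi),
      (a t ^ 3 * ((v .p).at h.le q t * (u .o).at h.le q t - (v .o).at h.le q t * (u .p).at h.le q t)
        - a b ^ 3 * ((v .p).at h.le q b * (u .o).at h.le q b
          - (v .o).at h.le q b * (u .p).at h.le q b)) := by
  have ha := H.cont
  have ha' := H.cont'
  -- The term a v u is added and subtracted, separating the vertical identity from a remainder that
  -- is handled horizontally.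
  have hsplit : ∀ q, ∫ p in b..t,
      (a p ^ 3 * (v .pp).at h.le q p + 3 * a p ^ 2 * a' p * (v .p).at h.le q p
        + a p * (v .qq).at h.le q p) * (u .o).at h.le q p =
      (a t ^ 3 * ((v .p).at h.le q t * (u .o).at h.le q t - (v .o).at h.le q t * (u .p).at h.le q t)
        - a b ^ 3 * ((v .p).at h.le q b * (u .o).at h.le q b
          - (v .o).at h.le q b * (u .p).at h.le q b))
      + ∫ p in b..t, a p * ((v .qq).at h.le q p * (u .o).at h.le q p
        + (v .o).at h.le q p * (u .o).at h.le q p) := fun q => by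
    rw [← H.integral_green_vertical hv q, ← intervalIntegral.integral_add
      (Continuous.intervalIntegrable (by fun_prop) _ _)
      (Continuous.intervalIntegrable (by fun_prop) _ _)]
    refine intervalIntegral.integral_congr fun p _ => ?_
    ring
  have hc : Continuous fun x : ℝ × ℝ => a x.2 * ((v .qq).at h.le x.1 x.2 * (u .o).at h.le x.1 x.2
      + (v .o).at h.le x.1 x.2 * (u .o).at h.le x.1 x.2) := by fun_prop
  have hzero : ∫ q in (0 : ℝ)..(2 * Real.pi), ∫ p in b..t,
      a p * ((v .qq).at h.le q p * (u .o).at h.le q p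
        + (v .o).at h.le q p * (u .o).at h.le q p) = 0 := by
    -- The weight a depends on p only, so once q is the inner variable it factors out and the
    -- horizontal identity applies.
    rw [MeasureTheory.intervalIntegral_intervalIntegral_swap]
    · rw [intervalIntegral.integral_congr (g := fun _ => 0), intervalIntegral.integral_zero]
      intro p hp
      rw [uIcc_of_le h.le] at hp
      simp only [intervalIntegral.integral_const_mul, H.integral_green_horizontal hv hp, mul_zero]
    · exact (hc.continuousOn.integrableOn_compact (isCompact_uIcc.prod isCompact_uIcc)).mono_set
        (prod_mono uIoc_subset_uIcc uIoc_subset_uIcc)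
  rw [intervalIntegral.integral_congr fun q _ => hsplit q, intervalIntegral.integral_add
    (Continuous.intervalIntegrable (by fun_prop) _ _)
    ((intervalIntegral.continuous_parametric_intervalIntegral_of_continuous' hc _
      _).intervalIntegrable _ _), hzero, add_zero]

end IsStripMode

/-! ### The kernel element, the annihilated range and the sign of the pairing. -/

namespace WindWave

open HolderSpace

variable {W : WindWave} {lam : ℝ} {φ₁ : ℝ → ℝ} {φ : W.X}

/-- Γ and Γ' = γ/Γ are extended by constants outside [p₁, 0], because `IsStripMode` asks for
continuity on the whole line. -/
theorem air_isStripMode (hφ₁ : W.SolvesMode 1 lam φ₁) (hφ : W.IsCosMode φ₁ φ) :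
    IsStripMode W.p₁_neg (fun p => W.Γ (projIcc W.p₁ 0 W.p₁_neg.le p))
      (fun p => W.vorticity (projIcc W.p₁ 0 W.p₁_neg.le p)
        * W.invΓ (projIcc W.p₁ 0 W.p₁_neg.le p)) φ₁ φ.1.1 where
  mem := φ.2.1
  cont := (continuousOn_iff_continuous_domRestrict.1 W.continuousOn_Γ).comp continuous_projIcc
  cont' := (W.vorticity.continuous.comp continuous_projIcc).mul
    (W.invΓ.continuous.comp continuous_projIcc)
  hasDeriv := fun p hp => by
    simp only [vorticity_apply, invΓ_apply, projIcc_of_mem W.p₁_neg.le hp]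
    exact (W.hasDerivWithinAt_Γ hp).congr
      (fun s hs => by rw [projIcc_of_mem W.p₁_neg.le hs]) (by rw [projIcc_of_mem W.p₁_neg.le hp])
  diff := hφ₁.diff_air
  ode := fun p hp => by
    have h := hφ₁.air p hp
    rw [projIcc_of_mem W.p₁_neg.le (Ioo_subset_Icc_self hp)]
    simp only [Nat.cast_one, one_pow, one_mul] at h
    refine h.congr_of_eventuallyEq ?_
    filter_upwards [Ioo_mem_nhds hp.1 hp.2] with s hs
    rw [projIcc_of_mem W.p₁_neg.le (Ioo_subset_Icc_self hs)]
  eq := hφ.1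

theorem water_isStripMode (hφ₁ : W.SolvesMode 1 lam φ₁) (hφ : W.IsCosMode φ₁ φ) :
    IsStripMode W.p₀_lt (fun _ => lam) (fun _ => 0) φ₁ φ.1.2 where
  mem := φ.2.2.1
  cont := continuous_const
  cont' := continuous_const
  hasDeriv := fun p _ => hasDerivWithinAt_const p _ lam
  diff := hφ₁.diff_water
  ode := fun p hp => by simpa using hφ₁.water p hp
  eq := hφ.2

theorem air_equation (hφ₁ : W.SolvesMode 1 lam φ₁) (hφ : W.IsCosMode φ₁ φ) (q : ℝ) {p : ℝ}
    (hp : p ∈ Icc W.p₁ 0) :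
    W.Γ p ^ 3 * X.air φ .pp q p + 3 * W.Γ p * W.γ (-p) * X.air φ .p q p
      = W.Γ p * X.air φ .o q p := by
  have h := (air_isStripMode hφ₁ hφ).equation q hp
  have h0 := (W.Γ_pos p hp).ne'
  simp only [vorticity_apply, invΓ_apply, projIcc_of_mem W.p₁_neg.le hp] at h
  rw [X.air, X.air, X.air, ← h]
  field_simp

theorem air_qq_eq (hφ₁ : W.SolvesMode 1 lam φ₁) (hφ : W.IsCosMode φ₁ φ) (q : ℝ) {p : ℝ}
    (hp : p ∈ Icc W.p₁ 0) : X.air φ .qq q p = -X.air φ .o q p :=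
  (air_isStripMode hφ₁ hφ).qq_eq q hp

theorem water_qq_eq (hφ₁ : W.SolvesMode 1 lam φ₁) (hφ : W.IsCosMode φ₁ φ) (q : ℝ) {p : ℝ}
    (hp : p ∈ Icc W.p₀ W.p₁) : X.water φ .qq q p = -X.water φ .o q p :=
  (water_isStripMode hφ₁ hφ).qq_eq q hp

theorem air_lid (hφ₁ : W.SolvesMode 1 lam φ₁) (hφ : W.IsCosMode φ₁ φ) (q : ℝ) :
    X.air φ .o q 0 = 0 := by
  rw [hφ.1 q 0 W.right_mem_air, hφ₁.lid, zero_mul]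

/-- The linearized dynamic condition on the interface. -/
theorem interface_equation (hφ₁ : W.SolvesMode 1 lam φ₁) (hφ : W.IsCosMode φ₁ φ) (q : ℝ) :
    2 * W.Γ W.p₁ ^ 3 * X.air φ .p q W.p₁ - 2 * lam ^ 3 * X.water φ .p q W.p₁
      - 2 * W.g * W.ρJump * X.air φ .o q W.p₁ = -W.σ * X.air φ .o q W.p₁ := by
  have h := hφ₁.jump
  have ha : X.air φ .p q W.p₁ = _ := (air_isStripMode hφ₁ hφ).p_eq q W.left_mem_air
  have hw : X.water φ .p q W.p₁ = _ := (water_isStripMode hφ₁ hφ).p_eq q W.right_mem_water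
  rw [ha, hw, hφ.1 q _ W.left_mem_air]
  simp only [Nat.cast_one, one_pow] at h
  linear_combination Real.cos q * h

theorem mean_airTrace_eq_zero (hφ : W.IsCosMode φ₁ φ) : mean (W.airTrace .o φ) = 0 := by
  have h : (⇑(W.airTrace .o φ).toBCF) = fun s => φ₁ W.p₁ * Real.cos s :=
    funext fun s => (airTrace_apply φ .o s).trans (hφ.1 s _ W.left_mem_air)
  simp [h, depth]

/-- Multiplied by a³, the bulk components become the mode equation, since φ_qq = -φ. The depth term
drops out because cos q has mean zero. -/
theorem Fm_mode_eq_zero (hlam : 0 < lam) (hφ₁ : W.SolvesMode 1 lam φ₁) (hφ : W.IsCosMode φ₁ φ) :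
    W.Fm lam φ = 0 := by
  refine Prod.ext (Subtype.ext (ext fun ⟨q, p⟩ => ?_)) (Prod.ext (Subtype.ext
    (ext fun ⟨q, p⟩ => ?_)) (Prod.ext (Subtype.ext (ext fun q => ?_)) (Subtype.ext ?_)))
  · have h0 := (W.Γ_pos p p.2).ne'
    refine (at_coe _ W.p₁_neg.le q p).symm.trans ?_
    rw [Fm_air hlam φ q p.2, air_qq_eq hφ₁ hφ q p.2]
    refine mul_left_cancel₀ (pow_ne_zero 3 h0) ?_
    change _ = W.Γ p ^ 3 * 0
    have h := air_equation hφ₁ hφ q p.2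
    field_simp
    refine mul_left_cancel₀ h0 ?_
    linear_combination h
  · refine (at_coe _ W.p₀_lt.le q p).symm.trans ?_
    rw [Fm_water hlam φ q p, water_qq_eq hφ₁ hφ q p.2]
    have h : lam ^ 3 * X.water φ .pp q p + 3 * lam ^ 2 * 0 * X.water φ .p q p
      = lam * X.water φ .o q p := (water_isStripMode hφ₁ hφ).equation q p.2
    refine mul_left_cancel₀ (pow_ne_zero 3 hlam.ne') ?_
    change _ = lam ^ 3 * 0
    field_simp
    refine mul_left_cancel₀ hlam.ne' ?_
    linear_combination h
  · refine (Fm_interface hlam φ q).trans ?_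
    rw [air_qq_eq hφ₁ hφ q W.left_mem_air]
    change _ = (0 : ℝ)
    linear_combination interface_equation hφ₁ hφ q
  · refine lineC2_ext (W.Fm lam φ).2.2.2.2 (Submodule.zero_mem _) fun q => ?_
    rw [Fm_lid hlam, mean_airTrace_eq_zero hφ, air_lid hφ₁ hφ, sub_zero]
    rfl

theorem pairing_Fm (hlam : 0 < lam) (hφ₁ : W.SolvesMode 1 lam φ₁) (hφ : W.IsCosMode φ₁ φ)
    (m : W.X) : W.pairing lam (W.Fm lam m) φ = 0 := by
  have Ha := air_isStripMode hφ₁ hφ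
  have Hw := water_isStripMode hφ₁ hφ
  have h1 : (∫ q in (0 : ℝ)..(2 * Real.pi), ∫ p in W.p₁..0,
      W.Γ p ^ 3 * (W.Fm lam m).1.1.at W.p₁_neg.le q p * X.air φ .o q p) =
      ∫ q in (0 : ℝ)..(2 * Real.pi),
        (W.Γ 0 ^ 3 * (X.air m .p q 0 * X.air φ .o q 0 - X.air m .o q 0 * X.air φ .p q 0)
          - W.Γ W.p₁ ^ 3 * (X.air m .p q W.p₁ * X.air φ .o q W.p₁
            - X.air m .o q W.p₁ * X.air φ .p q W.p₁)) := by
    have h := Ha.integral_green m.2.1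
    rw [projIcc_of_mem W.p₁_neg.le W.left_mem_air, projIcc_of_mem W.p₁_neg.le W.right_mem_air] at h
    refine Eq.trans (intervalIntegral.integral_congr fun q _ =>
      intervalIntegral.integral_congr fun p hp => ?_) h
    rw [uIcc_of_le W.p₁_neg.le] at hp
    have h0 := (W.Γ_pos p hp).ne'
    simp only [Fm_air hlam m q hp, vorticity_apply, invΓ_apply, projIcc_of_mem W.p₁_neg.le hp,
      X.air]
    field_simp
    ring
  have h2 : (∫ q in (0 : ℝ)..(2 * Real.pi), ∫ p in W.p₀..W.p₁,
      lam ^ 3 * (W.Fm lam m).2.1.1.at W.p₀_lt.le q p * X.water φ .o q p) =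
      ∫ q in (0 : ℝ)..(2 * Real.pi),
        (lam ^ 3 * (X.water m .p q W.p₁ * X.water φ .o q W.p₁
            - X.water m .o q W.p₁ * X.water φ .p q W.p₁)
          - lam ^ 3 * (X.water m .p q W.p₀ * X.water φ .o q W.p₀
            - X.water m .o q W.p₀ * X.water φ .p q W.p₀)) := by
    refine Eq.trans (intervalIntegral.integral_congr fun q _ =>
      intervalIntegral.integral_congr fun p _ => ?_) (Hw.integral_green m.2.2.1)
    simp only [Fm_water hlam m q p, X.water]
    field_simp
    ring
  set c := mean (W.airTrace .o m)
  set d := X.air φ .p 0 0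
  -- The sum of all boundary densities. The weight 1/2 matches the factor 2 in front of a³ m_p in
  -- the third component, and the jump condition for φ, multiplied by m/2, removes the remaining
  -- terms in φ_p on the interface. What is left integrates to zero over a period.
  have hsum : ∀ q, (W.Γ 0 ^ 3 * (X.air m .p q 0 * X.air φ .o q 0
          - X.air m .o q 0 * X.air φ .p q 0)
        - W.Γ W.p₁ ^ 3 * (X.air m .p q W.p₁ * X.air φ .o q W.p₁
          - X.air m .o q W.p₁ * X.air φ .p q W.p₁))
      + (lam ^ 3 * (X.water m .p q W.p₁ * X.water φ .o q W.p₁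
            - X.water m .o q W.p₁ * X.water φ .p q W.p₁)
          - lam ^ 3 * (X.water m .p q W.p₀ * X.water φ .o q W.p₀
            - X.water m .o q W.p₀ * X.water φ .p q W.p₀))
      + 1 / 2 * ((2 * W.Γ W.p₁ ^ 3 * X.air m .p q W.p₁
        - 2 * W.g * W.ρJump * X.air m .o q W.p₁ - W.σ * X.air m .qq q W.p₁
        - 2 * lam ^ 3 * X.water m .p q W.p₁) * X.air φ .o q W.p₁)
      + W.Γ 0 ^ 3 * (X.air m .o q 0 - c) * X.air φ .p q 0 =
      -(W.σ / 2) * (X.air m .qq q W.p₁ * X.air φ .o q W.p₁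
        + X.air m .o q W.p₁ * X.air φ .o q W.p₁) - W.Γ 0 ^ 3 * c * d * Real.cos q := fun q => by
    have e1 : X.air φ .o q W.p₁ = X.water φ .o q W.p₁ := φ.2.2.2.1 q
    have e2 : X.air m .o q W.p₁ = X.water m .o q W.p₁ := m.2.2.2.1 q
    have e3 : X.water φ .o q W.p₀ = 0 := φ.2.2.2.2 q
    have e4 : X.water m .o q W.p₀ = 0 := m.2.2.2.2 q
    have e5 : X.air φ .p q 0 = d * Real.cos q := Ha.p_eq_zero_mul q W.right_mem_air
    have e6 := interface_equation hφ₁ hφ q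
    rw [e1] at e6 ⊢
    rw [e2, e3, e4, e5, air_lid hφ₁ hφ]
    linear_combination (1 / 2 * X.water m .o q W.p₁) * e6
  have hc : ∀ (x : W.X) (i : JetIx) (p : ℝ), Continuous fun q => X.air x i q p :=
    fun x i p => by unfold X.air; fun_prop
  have hc' : ∀ (x : W.X) (i : JetIx) (p : ℝ), Continuous fun q => X.water x i q p :=
    fun x i p => by unfold X.water; fun_prop
  have hg : ∫ q in (0 : ℝ)..(2 * Real.pi), (X.air m .qq q W.p₁ * X.air φ .o q W.p₁
        + X.air m .o q W.p₁ * X.air φ .o q W.p₁) = 0 :=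
    Ha.integral_green_horizontal m.2.1 W.left_mem_air
  rw [pairing, h1, h2]
  simp only [Fm_interface hlam, Fm_lid hlam]
  rw [← intervalIntegral.integral_const_mul, ← intervalIntegral.integral_add,
    ← intervalIntegral.integral_add, ← intervalIntegral.integral_add,
    intervalIntegral.integral_congr fun q _ => hsum q, intervalIntegral.integral_sub,
    intervalIntegral.integral_const_mul, intervalIntegral.integral_const_mul, hg, integral_cos]
  · simp
  all_goals exact Continuous.intervalIntegrable (by fun_prop) _ _

theorem pairing_Flm (hlam : 0 < lam) (hφ₁ : W.SolvesMode 1 lam φ₁) (hφ : W.IsCosMode φ₁ φ) :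
    W.pairing lam (W.Flm lam φ) φ =
      -(∫ q in (0 : ℝ)..(2 * Real.pi), ∫ p in W.p₀..W.p₁, X.water φ .o q p ^ 2)
        - 3 * lam ^ 2 *
          ∫ q in (0 : ℝ)..(2 * Real.pi), ∫ p in W.p₀..W.p₁, X.water φ .p q p ^ 2 := by
  have Hw := water_isStripMode hφ₁ hφ
  have hc : ∀ i, Continuous fun x : ℝ × ℝ => X.water φ i x.1 x.2 ^ 2 :=
    fun i => by unfold X.water; fun_prop
  have hc1 : ∀ i q, Continuous fun p => X.water φ i q p ^ 2 :=
    fun i q => by unfold X.water; fun_prop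
  have hc2 : ∀ i, Continuous fun q => ∫ p in W.p₀..W.p₁, X.water φ i q p ^ 2 := fun i =>
    intervalIntegral.continuous_parametric_intervalIntegral_of_continuous' (hc i) _ _
  -- The energy identity in the water, where φ vanishes on the bed, divided by λ and multiplied by
  -- -6.
  have h1 : ∀ q, (W.Flm lam φ).2.2.1.1 q * X.air φ .o q W.p₁ =
      -6 * ((∫ p in W.p₀..W.p₁, X.water φ .o q p ^ 2)
        + lam ^ 2 * ∫ p in W.p₀..W.p₁, X.water φ .p q p ^ 2) := fun q => by
    have he : ∫ p in W.p₀..W.p₁, (lam * X.water φ .o q p ^ 2 + lam ^ 3 * X.water φ .p q p ^ 2) =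
      lam ^ 3 * X.water φ .p q W.p₁ * X.water φ .o q W.p₁
        - lam ^ 3 * X.water φ .p q W.p₀ * X.water φ .o q W.p₀ := Hw.integral_energy q
    have e1 : X.air φ .o q W.p₁ = X.water φ .o q W.p₁ := φ.2.2.2.1 q
    have e3 : X.water φ .o q W.p₀ = 0 := φ.2.2.2.2 q
    rw [intervalIntegral.integral_add (((hc1 .o q).const_mul _).intervalIntegrable _ _)
      (((hc1 .p q).const_mul _).intervalIntegrable _ _), intervalIntegral.integral_const_mul,
      intervalIntegral.integral_const_mul, e3] at he
    rw [Flm_interface hlam, e1]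
    refine mul_left_cancel₀ hlam.ne' ?_
    linear_combination 6 * he
  -- Here -2λ⁻³ φ_qq = 2λ⁻³ φ, and the weight λ³ cancels the power. With half of the -6 from the
  -- interface, the coefficient of ∬φ² is 2 - 3 = -1.
  have h2 : ∀ q, ∫ p in W.p₀..W.p₁,
      lam ^ 3 * (W.Flm lam φ).2.1.1.at W.p₀_lt.le q p * X.water φ .o q p =
      2 * ∫ p in W.p₀..W.p₁, X.water φ .o q p ^ 2 := fun q => by
    rw [← intervalIntegral.integral_const_mul]
    refine intervalIntegral.integral_congr fun p hp => ?_
    rw [uIcc_of_le W.p₀_lt.le] at hp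
    simp only [Flm_water hlam, water_qq_eq hφ₁ hφ q hp]
    field_simp
  have h3 : ∀ q p, (W.Flm lam φ).1.1.at W.p₁_neg.le q p = 0 := fun q p => by
    rw [Flm_air hlam]; rfl
  have h4 : ∀ q, (W.Flm lam φ).2.2.2.1 0 q = 0 := fun q => by
    rw [Flm_lid hlam]; rfl
  simp only [pairing, h1, h2, h3, h4, mul_zero, zero_mul, intervalIntegral.integral_zero,
    intervalIntegral.integral_const_mul]
  rw [intervalIntegral.integral_add ((hc2 .o).intervalIntegrable _ _)
    (((hc2 .p).const_mul _).intervalIntegrable _ _), intervalIntegral.integral_const_mul]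
  ring

/-- A mode that vanishes in the water vanishes identically. -/
theorem exists_water_ne_zero (hφ₁ : W.SolvesMode 1 lam φ₁) (hφ : W.IsCosMode φ₁ φ) (hφ0 : φ ≠ 0) :
    ∃ p ∈ Icc W.p₀ W.p₁, φ₁ p ≠ 0 := by
  by_contra! hz
  have Ha := air_isStripMode hφ₁ hφ
  refine hφ0 (Subtype.ext (Prod.ext (eq_zero_of_mem_stripC2 W.p₁_neg φ.2.1 fun q p hp => ?_)
    (eq_zero_of_mem_stripC2 W.p₀_lt φ.2.2.1 fun q p hp => ?_)))
  · have hc := Ha.cont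
    -- By continuity at p₁ the mode vanishes at both ends of the air interval, so its energy there
    -- is zero; a nonzero value of φ would make it positive.
    have he := Ha.integral_energy q
    have e1 : (φ.1.1 .o).at W.p₁_neg.le q 0 = 0 := air_lid hφ₁ hφ q
    have e2 : (φ.1.1 .o).at W.p₁_neg.le q W.p₁ = 0 := by
      rw [Ha.eq q _ W.left_mem_air, hz _ W.right_mem_water, zero_mul]
    rw [e1, e2, mul_zero, mul_zero, sub_zero] at he
    by_contra hne
    refine (intervalIntegral.integral_pos W.p₁_neg (by fun_prop) (fun s _ => ?_)
      ⟨p, hp, ?_⟩).ne' he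
    · have := W.Γ_pos _ (projIcc W.p₁ 0 W.p₁_neg.le s).2
      positivity
    · have := W.Γ_pos _ (projIcc W.p₁ 0 W.p₁_neg.le p).2
      positivity
  · exact (hφ.2 q p hp).trans (by rw [hz p hp, zero_mul])

theorem pairing_Flm_neg (hlam : 0 < lam) (hφ₁ : W.SolvesMode 1 lam φ₁) (hφ : W.IsCosMode φ₁ φ)
    (hφ0 : φ ≠ 0) : W.pairing lam (W.Flm lam φ) φ < 0 := by
  obtain ⟨p, hp, hne⟩ := exists_water_ne_zero hφ₁ hφ hφ0
  have hpi := Real.two_pi_pos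
  have h1 : 0 < ∫ q in (0 : ℝ)..(2 * Real.pi), ∫ p in W.p₀..W.p₁, X.water φ .o q p ^ 2 := by
    have hM := hφ₁.diff_water.continuousOn
    have hI : 0 < ∫ p in W.p₀..W.p₁, φ₁ p ^ 2 :=
      intervalIntegral.integral_pos W.p₀_lt (hM.pow 2) (fun _ _ => sq_nonneg _)
        ⟨p, hp, by positivity⟩
    -- Separation of variables: the double integral is the product of two integrals of continuous
    -- squares, neither identically zero.
    have he : ∀ q, ∫ p in W.p₀..W.p₁, X.water φ .o q p ^ 2 =
        Real.cos q ^ 2 * ∫ p in W.p₀..W.p₁, φ₁ p ^ 2 := fun q => by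
      rw [← intervalIntegral.integral_const_mul]
      refine intervalIntegral.integral_congr fun p hp => ?_
      rw [uIcc_of_le W.p₀_lt.le] at hp
      simp only [hφ.2 q p hp]
      ring
    simp only [he, intervalIntegral.integral_mul_const]
    refine mul_pos ?_ hI
    exact intervalIntegral.integral_pos hpi (by fun_prop) (fun _ _ => sq_nonneg _)
      ⟨0, ⟨le_rfl, hpi.le⟩, by simp⟩
  have h2 : 0 ≤ ∫ q in (0 : ℝ)..(2 * Real.pi), ∫ p in W.p₀..W.p₁, X.water φ .p q p ^ 2 :=
    intervalIntegral.integral_nonneg hpi.le fun q _ =>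
      intervalIntegral.integral_nonneg W.p₀_lt.le fun p _ => sq_nonneg _
  rw [pairing_Flm hlam hφ₁ hφ]
  have : 0 ≤ 3 * lam ^ 2 *
    ∫ q in (0 : ℝ)..(2 * Real.pi), ∫ p in W.p₀..W.p₁, X.water φ .p q p ^ 2 := by positivity
  linarith

end WindWave

/- The statement uses the normed space structure alone, without the multiplication. -/
attribute [-instance] HolderSpace.instCommRing HolderSpace.instNormedCommRing
  HolderSpace.instNormedAlgebra

theorem mainTheorem9 (W : WindWave) (lam : ℝ) (hlam : 0 < lam)
    (φ₁ : ℝ → ℝ) (hφ₁ : W.SolvesMode 1 lam φ₁)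
    (φ : W.X) (hφ : W.IsCosMode φ₁ φ) (hφ0 : φ ≠ 0) :
    (∀ μ > 0, ∀ m ∈ W.noStagnation μ, W.IsValue μ m (W.F μ m)) ∧
    (∀ μ > 0, DifferentiableAt ℝ (W.F μ) 0) ∧
    DifferentiableAt ℝ W.Fm lam ∧
    W.Fm lam φ = 0 ∧
    (∀ A ∈ Set.range (W.Fm lam), W.pairing lam A φ = 0) ∧
    W.Flm lam φ ∉ Set.range (W.Fm lam) ∧
    W.pairing lam (W.Flm lam φ) φ =
      -(∫ q in (0 : ℝ)..(2 * Real.pi), ∫ p in W.p₀..W.p₁, WindWave.X.water φ .o q p ^ 2)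
        - 3 * lam ^ 2 *
          ∫ q in (0 : ℝ)..(2 * Real.pi), ∫ p in W.p₀..W.p₁, WindWave.X.water φ .p q p ^ 2 ∧
    W.pairing lam (W.Flm lam φ) φ < 0 := by
  have hneg := WindWave.pairing_Flm_neg hlam hφ₁ hφ hφ0
  have hrange : ∀ A ∈ Set.range (W.Fm lam), W.pairing lam A φ = 0 := by
    rintro _ ⟨m, rfl⟩
    exact WindWave.pairing_Fm hlam hφ₁ hφ m
  exact ⟨fun μ _ m hm => WindWave.isValue_F hm,
    fun μ hμ => (W.hasFDerivAt_F hμ).differentiableAt,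
    WindWave.differentiableAt_Fm W hlam, WindWave.Fm_mode_eq_zero hlam hφ₁ hφ, hrange,
    fun h => hneg.ne (hrange _ h), WindWave.pairing_Flm hlam hφ₁ hφ, hneg⟩
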